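/- Let $G=(V,E)$ be a finite simple graph with edge weights $w\in\mathbb{R}^E_{\ge 0}$. A fractional matching of $G$ is a vector $x\in\mathbb{R}^E$ with $x\ge 0$ and $x(\delta(v))=\sum_{e\ni v}x_e\le 1$ for all $v\in V$; it is basic if it is a basic feasible solution of this linear system, i.e. an extreme point of its solution set. Write $\nu(G)$ for the maximum weight of a matching of $G$ and $\nu_f(G)$ for the maximum of $\sum_{e\in E} w_ex_e$ over the fractional matchings $x$ of $G$. Call $G$ stable if $\nu(G)=\nu_f(G)$, and call $F\subseteq E$ an edge-stabilizer of $G$ if $G\setminus F:=(V,E\setminus F)$, with the restricted weights, is stable. For a basic fractional matching $x$ let $\mathscr{C}(x)$ be the set of odd cycles $C$ of $G$ with $x_e=\tfrac12$ for all $e\in E(C)$, and let $\gamma(G)$ be the minimum of $|\mathscr{C}(x)|$ over all basic fractional matchings $x$ of weight $\nu_f(G)$. Then: 1. For every edge $e\in E$, $\gamma(G\setminus e)\ge\gamma(G)-2$. 2. For every edge-stabilizer $F$ of $G$, $|F|\ge\lceil\gamma(G)/2\rceil$. 3. The number $\gamma(G)$ is not in general a lower bound on the size of an edge-stabilizer: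 there are a graph $G$ on eight vertices with positive edge weights and an edge $e$ of $G$ such that $\gamma(G)=2$ and $\{e\}$ is an edge-stabilizer of $G$ of minimum cardinality. -/

import Mathlib

namespace WeightedMatching

variable {V : Type*} [Fintype V]

/- Throughout, an edge-weighted graph is a finite simple graph `G` with a weight function
`w : Sym2 V → ℝ` of which only the values on the edges of `G` are used.  A vector of `ℝ^E` is
written as its extension by zero, a function `x : Sym2 V → ℝ` that vanishes off `G.edgeSet`. -/

open Classical in
/-- The weight `∑_{e ∈ E} w_e x_e` of a vector `x`. -/
noncomputable def fracWeight (G : SimpleGraph V) (w x : Sym2 V → ℝ) : ℝ :=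
  ∑ e ∈ G.edgeFinset, w e * x e

open Classical in
/-- The fractional matching polytope
`{x ∈ ℝ^E : x(δ(v)) ≤ 1 for all v ∈ V, x ≥ 0}`. -/
def fracMatchings (G : SimpleGraph V) : Set (Sym2 V → ℝ) :=
  {x | (∀ e, e ∉ G.edgeSet → x e = 0) ∧ (∀ e ∈ G.edgeSet, 0 ≤ x e) ∧
    ∀ v, ∑ e ∈ G.incidenceFinset v, x e ≤ 1}

open Classical in
/-- The weight of the edges of a subgraph. -/
noncomputable def subgraphWeight (G : SimpleGraph V) (w : Sym2 V → ℝ) (M : G.Subgraph) : ℝ :=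
  ∑ e ∈ G.edgeFinset with e ∈ M.edgeSet, w e

/-- `ν(G)`, the value of a maximum-weight matching (a supremum over a finite nonempty set). -/
noncomputable def nu (G : SimpleGraph V) (w : Sym2 V → ℝ) : ℝ :=
  sSup {r | ∃ M : G.Subgraph, M.IsMatching ∧ subgraphWeight G w M = r}

/-- `ν_f(G)`, the value of a maximum-weight fractional matching (the supremum of a linear
function over a nonempty compact set). -/
noncomputable def nuFrac (G : SimpleGraph V) (w : Sym2 V → ℝ) : ℝ :=
  sSup (fracWeight G w '' fracMatchings G)

/-- `G` is stable if a maximum-weight matching and a maximum-weight fractional matching have the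
same value. -/
def IsStable (G : SimpleGraph V) (w : Sym2 V → ℝ) : Prop :=
  nu G w = nuFrac G w

/-- An edge-stabilizer is a set of edges of `G` whose deletion makes `G` stable. -/
def IsEdgeStabilizer (G : SimpleGraph V) (w : Sym2 V → ℝ) (F : Finset (Sym2 V)) : Prop :=
  (F : Set (Sym2 V)) ⊆ G.edgeSet ∧ IsStable (G.deleteEdges (F : Set (Sym2 V))) w

/-- An edge-stabilizer of minimum cardinality. -/
def IsMinEdgeStabilizer (G : SimpleGraph V) (w : Sym2 V → ℝ) (F : Finset (Sym2 V)) : Prop :=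
  IsEdgeStabilizer G w F ∧ ∀ F', IsEdgeStabilizer G w F' → F.card ≤ F'.card

/-- The basic maximum-weight fractional matchings: the basic feasible solutions (the vertices of
the fractional matching polytope) at which the weight is maximum. -/
def basicMaxFracMatchings (G : SimpleGraph V) (w : Sym2 V → ℝ) : Set (Sym2 V → ℝ) :=
  {x | x ∈ Set.extremePoints ℝ (fracMatchings G) ∧
    ∀ x' ∈ fracMatchings G, fracWeight G w x' ≤ fracWeight G w x}

/-- The set `𝒞(x)` of the odd cycles of `G` all of whose edges have value `1/2` in `x`.  A cycle
is taken as a subgraph, so it does not depend on a starting vertex or an orientation. -/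
def oddCycles (G : SimpleGraph V) (x : Sym2 V → ℝ) : Set G.Subgraph :=
  {C | ∃ (v : V) (p : G.Walk v v), p.IsCycle ∧ Odd p.length ∧
    (∀ e ∈ p.edges, x e = 1 / 2) ∧ C = p.toSubgraph}

/-- `γ(G)`, the minimum of `|𝒞(x)|` over the basic maximum-weight fractional matchings `x`. -/
noncomputable def gamma (G : SimpleGraph V) (w : Sym2 V → ℝ) : ℕ :=
  sInf ((fun x => (oddCycles G x).ncard) '' basicMaxFracMatchings G w)

open Classical in
/-- The fractional matching polytope is compact. -/
theorem isCompact_fracMatchings (G : SimpleGraph V) : IsCompact (fracMatchings G) := by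
  have hsub : fracMatchings G ⊆ Set.Icc (fun _ => (0 : ℝ)) (fun _ => 1) := by
    rintro x ⟨h0, hn, h1⟩
    have hn' : ∀ e, 0 ≤ x e := fun e => by
      by_cases he : e ∈ G.edgeSet
      · exact hn e he
      · exact (h0 e he).ge
    refine ⟨hn', fun e => ?_⟩
    by_cases he : e ∈ G.edgeSet
    · induction e with
      | _ a b =>
        refine le_trans ?_ (h1 a)
        refine Finset.single_le_sum (f := x) (fun i _ => hn' i) ?_
        rw [SimpleGraph.mem_incidenceFinset]
        exact ⟨he, Sym2.mem_mk_left a b⟩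
    · rw [h0 e he]; exact zero_le_one
  refine isCompact_Icc.of_isClosed_subset ?_ hsub
  simp only [fracMatchings, Set.ofPred_and, Set.ofPred_forall]
  refine IsClosed.inter ?_ (IsClosed.inter ?_ ?_)
  · exact isClosed_iInter fun e => isClosed_iInter fun _ =>
      isClosed_eq (continuous_apply e) continuous_const
  · exact isClosed_iInter fun e => isClosed_iInter fun _ =>
      isClosed_le continuous_const (continuous_apply e)
  · exact isClosed_iInter fun v => isClosed_le
      (continuous_finsetSum _ fun e _ => continuous_apply e) continuous_const

/-- A basic maximum-weight fractional matching exists, so the minimum that defines `γ` is taken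
over a nonempty set. -/
theorem basicMaxFracMatchings_nonempty (G : SimpleGraph V) (w : Sym2 V → ℝ) :
    (basicMaxFracMatchings G w).Nonempty := by
  classical
  let l : StrongDual ℝ (Sym2 V → ℝ) :=
    ∑ e ∈ G.edgeFinset, w e • ContinuousLinearMap.proj e
  have hl : ∀ x, l x = fracWeight G w x := by
    intro x
    simp [l, fracWeight]
  have hne : (fracMatchings G).Nonempty := ⟨0, by simp [fracMatchings]⟩
  obtain ⟨x, hx, hmax⟩ :=
    (isCompact_fracMatchings G).exists_isMaxOn hne l.continuous.continuousOn
  have hexp : IsExposed ℝ (fracMatchings G) (l.toExposed (fracMatchings G)) :=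
    ContinuousLinearMap.toExposed.isExposed
  obtain ⟨z, hz⟩ := (hexp.isCompact (isCompact_fracMatchings G)).extremePoints_nonempty
    ⟨x, hx, fun y hy => hmax hy⟩
  refine ⟨z, hexp.isExtreme.extremePoints_subset_extremePoints hz, fun y hy => ?_⟩
  rw [← hl, ← hl]
  exact hz.1.2 y hy

end WeightedMatching

/- Let `y` be an optimal fractional `w`-vertex cover, `T` the graph of its tight edges and
`B = {v | 0 < y v}`.  By complementary slackness the maximum-weight fractional matchings are the
fractional matchings of `T` that saturate `B`, and by Birkhoff's theorem the basic ones come from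
permutations `σ` that move vertices along edges of `T`; their odd cycles are the cycles of `σ` of
length at least three.  Removing one vertex from each of these cycles leaves an even number of
vertices, which `T` matches along the cycle; conversely, exchanging along alternating paths
turns a matching of `T` that misses few vertices of `B` into a basic optimal vector with few odd
cycles.  Hence `γ(G)` is the least number of vertices of `B` missed by a matching of `T`.

`G` and the graph `G - v` without the edges at `v` have optimal covers that agree off `v`, so that
in this description passing from one to the other changes `γ` by at most one.  Deleting an edge `e`
with an end `v` gives `(G \ e) - v = G - v`, which compares `γ(G)` with `γ(G \ e)` in two steps of
this kind.  A stable graph has `γ = 0`, and the bound for edge-stabilizers follows by deleting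
their edges one at a time. -/

namespace WeightedMatching

section EdgeSums

variable {V : Type*} [Fintype V]

open Classical in
theorem sum_incidenceFinset (G : SimpleGraph V) {x : Sym2 V → ℝ} (hx : ∀ e, e ∉ G.edgeSet → x e = 0)
    (v : V) : ∑ e ∈ G.incidenceFinset v, x e = ∑ u, x s(v, u) := by
  have himage : G.incidenceFinset v = (G.neighborFinset v).image (fun u => s(v, u)) := by
    ext e
    induction e with
    | _ a b =>
      simp only [SimpleGraph.mem_incidenceFinset, SimpleGraph.mk'_mem_incidenceSet_iff,
        Finset.mem_image, SimpleGraph.mem_neighborFinset]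
      constructor
      · rintro ⟨hab, rfl | rfl⟩
        · exact ⟨b, hab, rfl⟩
        · exact ⟨a, hab.symm, Sym2.eq_swap⟩
      · rintro ⟨u, hu, he⟩
        rcases Sym2.eq_iff.1 he with ⟨rfl, rfl⟩ | ⟨rfl, rfl⟩
        · exact ⟨hu, Or.inl rfl⟩
        · exact ⟨hu.symm, Or.inr rfl⟩
  rw [himage, Finset.sum_image (fun a _ b _ h => Sym2.congr_right.1 h)]
  refine Finset.sum_subset (Finset.subset_univ _) fun u _ hu => hx _ ?_
  rwa [SimpleGraph.mem_neighborFinset] at hu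

open Classical in
theorem two_mul_sum_edgeFinset (G : SimpleGraph V) {x : Sym2 V → ℝ}
    (hx : ∀ e, e ∉ G.edgeSet → x e = 0) :
    2 * ∑ e ∈ G.edgeFinset, x e = ∑ u, ∑ v, x s(u, v) := by
  have hrow : ∀ u, ∑ v, x s(u, v) = ∑ e ∈ G.edgeFinset, if u ∈ e then x e else 0 := by
    intro u
    rw [← sum_incidenceFinset G hx, SimpleGraph.incidenceFinset_eq_filter, Finset.sum_filter]
  simp_rw [hrow]
  rw [Finset.sum_comm, Finset.mul_sum]
  refine Finset.sum_congr rfl fun e he => ?_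
  induction e with
  | _ a b =>
    have hab : a ≠ b := by
      rw [SimpleGraph.mem_edgeFinset, SimpleGraph.mem_edgeSet] at he
      exact he.ne
    rw [← Finset.sum_filter]
    have hends : Finset.univ.filter (fun u => u ∈ s(a, b)) = {a, b} := by ext; simp
    rw [hends, Finset.sum_pair hab]
    ring

theorem mem_fracMatchings_iff (G : SimpleGraph V) (x : Sym2 V → ℝ) :
    x ∈ fracMatchings G ↔ (∀ e, e ∉ G.edgeSet → x e = 0) ∧ (∀ e, 0 ≤ x e) ∧
      ∀ v, ∑ u, x s(v, u) ≤ 1 := by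
  constructor
  · rintro ⟨h0, h1, h2⟩
    refine ⟨h0, fun e => ?_, fun v => ?_⟩
    · by_cases he : e ∈ G.edgeSet
      · exact h1 e he
      · exact (h0 e he).ge
    · rw [← sum_incidenceFinset G h0]; exact h2 v
  · rintro ⟨h0, h1, h2⟩
    refine ⟨h0, fun e _ => h1 e, fun v => ?_⟩
    rw [sum_incidenceFinset G h0]; exact h2 v

theorem two_mul_fracWeight (G : SimpleGraph V) (w : Sym2 V → ℝ) {x : Sym2 V → ℝ}
    (hx : ∀ e, e ∉ G.edgeSet → x e = 0) :
    2 * fracWeight G w x = ∑ u, ∑ v, w s(u, v) * x s(u, v) := by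
  classical
  exact two_mul_sum_edgeFinset G (x := fun e => w e * x e) fun e he => by simp [hx e he]

theorem fracWeight_eq_of_le {G H : SimpleGraph V} (w : Sym2 V → ℝ) {x : Sym2 V → ℝ} (hGH : G ≤ H)
    (hx : ∀ e, e ∉ G.edgeSet → x e = 0) : fracWeight H w x = fracWeight G w x := by
  have hG := two_mul_fracWeight G w hx
  have hH := two_mul_fracWeight H w (x := x) fun e he =>
    hx e fun h => he (SimpleGraph.edgeSet_mono hGH h)
  linarith

theorem sum_sub_fracWeight (G : SimpleGraph V) (w : Sym2 V → ℝ) {x : Sym2 V → ℝ}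
    (hx : ∀ e, e ∉ G.edgeSet → x e = 0) (y : V → ℝ) :
    2 * (∑ v, y v - fracWeight G w x) = 2 * ∑ u, y u * (1 - ∑ v, x s(u, v)) +
      ∑ u, ∑ v, (y u + y v - w s(u, v)) * x s(u, v) := by
  have hweight := two_mul_fracWeight G w hx
  have hswap : ∑ u, ∑ v, y v * x s(u, v) = ∑ u, ∑ v, y u * x s(u, v) := by
    rw [Finset.sum_comm]
    exact Finset.sum_congr rfl fun u _ => Finset.sum_congr rfl fun v _ => by rw [Sym2.eq_swap]
  simp only [sub_mul, add_mul, mul_sub, mul_one, Finset.sum_sub_distrib, Finset.sum_add_distrib,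
    Finset.mul_sum, hswap] at hweight ⊢
  simp only [← Finset.mul_sum] at hweight ⊢
  linarith

theorem mem_fracMatchings_of_le {G H : SimpleGraph V} (h : G ≤ H) {x : Sym2 V → ℝ}
    (hx : x ∈ fracMatchings G) : x ∈ fracMatchings H := by
  rw [mem_fracMatchings_iff] at hx ⊢
  exact ⟨fun e he => hx.1 e fun h' => he (SimpleGraph.edgeSet_mono h h'), hx.2⟩

theorem convex_fracMatchings (G : SimpleGraph V) : Convex ℝ (fracMatchings G) := by
  intro x hx z hz s t hs ht hst
  rw [mem_fracMatchings_iff] at hx hz ⊢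
  refine ⟨fun e he => by simp [hx.1 e he, hz.1 e he], fun e => ?_, fun v => ?_⟩
  · have := hx.2.1 e
    have := hz.2.1 e
    simp only [Pi.add_apply, Pi.smul_apply, smul_eq_mul]
    positivity
  · simp only [Pi.add_apply, Pi.smul_apply, smul_eq_mul, Finset.sum_add_distrib, ← Finset.mul_sum]
    nlinarith [hx.2.2 v, hz.2.2 v]

theorem isExtreme_fracMatchings_of_le {G H : SimpleGraph V} (h : G ≤ H) :
    IsExtreme ℝ (fracMatchings H) (fracMatchings G) := by
  refine ⟨fun x hx => mem_fracMatchings_of_le h hx, ?_⟩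
  rintro x hx z hz _ hm ⟨a, b, ha, hb, -, rfl⟩
  rw [mem_fracMatchings_iff] at hx hz hm ⊢
  refine ⟨fun e he => ?_, hx.2⟩
  have hsum : a * x e + b * z e = 0 := hm.1 e he
  have hze := mul_nonneg hb.le (hz.2.1 e)
  have hxe := mul_nonneg ha.le (hx.2.1 e)
  exact (mul_eq_zero.1 (show a * x e = 0 by linarith)).resolve_left ha.ne'

end EdgeSums

section Permutations

variable {V : Type*}

open Classical in
/-- The half-integral vector of a permutation: `x_{uv}` is half the number of the relations
`σ u = v` and `σ v = u` that hold, so that a transposition becomes a matching edge of value `1` and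
a longer cycle of `σ` a cycle of value `1/2`. -/
noncomputable def permVec (σ : Equiv.Perm V) : Sym2 V → ℝ :=
  Sym2.lift ⟨fun u v => if u = v then 0 else
    ((if σ u = v then 1 else 0) + (if σ v = u then 1 else 0)) / 2, fun u v => by
      simp only [eq_comm (a := u) (b := v)]
      split_ifs <;> simp⟩

open Classical in
theorem permVec_mk (σ : Equiv.Perm V) (u v : V) : permVec σ s(u, v) = if u = v then 0 else
    ((if σ u = v then 1 else 0) + (if σ v = u then 1 else 0)) / 2 := rfl

theorem permVec_nonneg (σ : Equiv.Perm V) (e : Sym2 V) : 0 ≤ permVec σ e := by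
  induction e with
  | _ a b => rw [permVec_mk]; split_ifs <;> norm_num

theorem permVec_ne_zero {σ : Equiv.Perm V} {u v : V} :
    permVec σ s(u, v) ≠ 0 ↔ u ≠ v ∧ (σ u = v ∨ σ v = u) := by
  rw [permVec_mk]
  by_cases huv : u = v <;> by_cases h1 : σ u = v <;> by_cases h2 : σ v = u <;> simp [huv, h1, h2]

/-- The permutation moves every vertex along an edge or fixes it. -/
def MovesAlong (G : SimpleGraph V) (σ : Equiv.Perm V) : Prop :=
  ∀ u, σ u = u ∨ G.Adj u (σ u)

theorem MovesAlong.mono {G H : SimpleGraph V} {σ : Equiv.Perm V} (hσ : MovesAlong G σ)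
    (h : G ≤ H) : MovesAlong H σ :=
  fun u => (hσ u).imp_right (h ·)

theorem movesAlong_iff_permVec_eq_zero {G : SimpleGraph V} {σ : Equiv.Perm V} :
    MovesAlong G σ ↔ ∀ e ∉ G.edgeSet, permVec σ e = 0 := by
  constructor
  · intro hσ e he
    induction e with
    | _ a b =>
      by_contra h
      obtain ⟨hab, rfl | rfl⟩ := permVec_ne_zero.1 h
      · exact he ((hσ a).resolve_left hab.symm)
      · exact he ((hσ b).resolve_left hab).symm
  · intro h u
    by_contra! hu
    exact permVec_ne_zero.2 ⟨hu.1.symm, Or.inl rfl⟩ (h _ hu.2)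

variable [Fintype V]

open Classical in
theorem sum_permVec (σ : Equiv.Perm V) (u : V) :
    ∑ v, permVec σ s(u, v) = if σ u = u then 0 else 1 := by
  have hsymm : ∀ v, σ v = u ↔ σ.symm u = v := fun v => by rw [Equiv.symm_apply_eq, eq_comm]
  by_cases hu : σ u = u
  · rw [if_pos hu]
    refine Finset.sum_eq_zero fun v _ => by_contra fun h => ?_
    obtain ⟨huv, h | h⟩ := permVec_ne_zero.1 h
    · exact huv (hu ▸ h)
    · exact huv (σ.injective (hu.trans h.symm))
  · have hval : ∀ v, permVec σ s(u, v) =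
        ((if σ u = v then 1 else 0) + (if σ.symm u = v then 1 else 0)) / 2 := fun v => by
      rw [permVec_mk]
      split_ifs with huv <;> grind
    simp_rw [hval, ← Finset.sum_div, Finset.sum_add_distrib, Finset.sum_ite_eq, Finset.mem_univ,
      if_true, if_neg hu]
    norm_num

theorem MovesAlong.permVec_mem_fracMatchings {G : SimpleGraph V} {σ : Equiv.Perm V}
    (hσ : MovesAlong G σ) : permVec σ ∈ fracMatchings G := by
  rw [mem_fracMatchings_iff]
  refine ⟨movesAlong_iff_permVec_eq_zero.1 hσ, permVec_nonneg σ, fun v => ?_⟩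
  rw [sum_permVec]
  split_ifs <;> norm_num

open Classical in
/-- The doubly stochastic matrix with the values of `x` off the diagonal and the slacks
`1 - x(δ(u))` on it. -/
noncomputable def slackMatrix (x : Sym2 V → ℝ) : Matrix V V ℝ :=
  Matrix.of fun u v => if u = v then 1 - ∑ t, x s(u, t) else x s(u, v)

theorem slackMatrix_mem_doublyStochastic [DecidableEq V] {G : SimpleGraph V} {x : Sym2 V → ℝ}
    (hx : x ∈ fracMatchings G) : slackMatrix x ∈ doublyStochastic ℝ V := by
  obtain ⟨h0, h1, h2⟩ := (mem_fracMatchings_iff G x).1 hx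
  have hsymm : ∀ u v, slackMatrix x u v = slackMatrix x v u := fun u v => by
    simp only [slackMatrix, Matrix.of_apply]
    split_ifs with h h' h'
    · rw [h]
    · exact absurd h.symm h'
    · exact absurd h'.symm h
    · rw [Sym2.eq_swap]
  have hrow : ∀ u, ∑ v, slackMatrix x u v = 1 := fun u => by
    have hval : ∀ v, slackMatrix x u v =
        x s(u, v) + if u = v then 1 - ∑ t, x s(u, t) else 0 := fun v => by
      simp only [slackMatrix, Matrix.of_apply]
      split_ifs with h
      · rw [← h, h0 s(u, u) (by simp), zero_add]
      · rw [add_zero]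
    simp [hval, Finset.sum_add_distrib]
  refine mem_doublyStochastic_iff_sum.2 ⟨fun u v => ?_, hrow, fun v => ?_⟩
  · simp only [slackMatrix, Matrix.of_apply]
    split_ifs
    · linarith [h2 u]
    · exact h1 _
  · simp_rw [hsymm _ v, hrow]

/-- This is Birkhoff's theorem, symmetrized. -/
theorem fracMatchings_subset_convexHull (G : SimpleGraph V) :
    fracMatchings G ⊆ convexHull ℝ (Set.range permVec) := by
  classical
  intro x hx
  obtain ⟨c, hc0, hc1, hcX⟩ :=
    exists_eq_sum_perm_of_mem_doublyStochastic (slackMatrix_mem_doublyStochastic hx)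
  have hentry : ∀ u v, u ≠ v → x s(u, v) = ∑ σ : Equiv.Perm V, c σ * if σ u = v then 1 else 0 := by
    intro u v huv
    have h := congrFun (congrFun hcX u) v
    simp only [slackMatrix, Matrix.of_apply, if_neg huv] at h
    rw [← h, Matrix.sum_apply]
    simp [Equiv.Perm.permMatrix, PEquiv.toMatrix_apply, Equiv.toPEquiv_apply]
  have hsum : x = ∑ σ : Equiv.Perm V, c σ • permVec σ := by
    ext e
    induction e with
    | _ u v =>
      simp only [Finset.sum_apply, Pi.smul_apply, smul_eq_mul, permVec_mk]
      by_cases huv : u = v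
      · simp [huv, hx.1 s(v, v) (by simp)]
      · have h : x s(u, v) = (x s(u, v) + x s(v, u)) / 2 := by rw [Sym2.eq_swap]; ring
        rw [h, hentry u v huv, hentry v u (Ne.symm huv), ← Finset.sum_add_distrib, Finset.sum_div]
        refine Finset.sum_congr rfl fun σ _ => ?_
        rw [if_neg huv]
        ring
  rw [hsum]
  exact (convex_convexHull ℝ _).sum_mem (fun σ _ => hc0 σ) hc1 fun σ _ =>
    subset_convexHull _ _ ⟨σ, rfl⟩

theorem exists_perm_of_mem_extremePoints {G : SimpleGraph V} {x : Sym2 V → ℝ}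
    (hx : x ∈ Set.extremePoints ℝ (fracMatchings G)) :
    ∃ σ, MovesAlong G σ ∧ x = permVec σ := by
  have hhull : convexHull ℝ (Set.range permVec) ⊆ fracMatchings (⊤ : SimpleGraph V) := by
    refine convexHull_min ?_ (convex_fracMatchings ⊤)
    rintro _ ⟨σ, rfl⟩
    exact MovesAlong.permVec_mem_fracMatchings fun u => (eq_or_ne (σ u) u).imp_right Ne.symm
  have hx' : x ∈ Set.extremePoints ℝ (convexHull ℝ (Set.range permVec)) :=
    inter_extremePoints_subset_extremePoints_of_subset hhull
      ⟨fracMatchings_subset_convexHull G hx.1,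
        (isExtreme_fracMatchings_of_le le_top).extremePoints_subset_extremePoints hx⟩
  obtain ⟨σ, rfl⟩ := extremePoints_convexHull_subset hx'
  exact ⟨σ, movesAlong_iff_permVec_eq_zero.2 hx.1.1, rfl⟩

end Permutations

section Duality

variable {V : Type*} {G : SimpleGraph V} {w : Sym2 V → ℝ} {y : V → ℝ}
  {σ : Equiv.Perm V}

/-- A fractional `w`-vertex cover, i.e. a feasible solution of the linear program dual to
maximum-weight fractional matching. -/
structure IsFracCover (G : SimpleGraph V) (w : Sym2 V → ℝ) (y : V → ℝ) : Prop where
  nonneg : ∀ v, 0 ≤ y v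
  le_add : ∀ u v, G.Adj u v → w s(u, v) ≤ y u + y v

/-- The edges at which the vector `y` of vertex values is tight. -/
def tightGraph (G : SimpleGraph V) (w : Sym2 V → ℝ) (y : V → ℝ) : SimpleGraph V where
  Adj u v := G.Adj u v ∧ w s(u, v) = y u + y v
  symm := ⟨fun u v h => ⟨h.1.symm, by rw [Sym2.eq_swap, h.2, add_comm]⟩⟩
  loopless := ⟨fun _ h => h.1.ne rfl⟩

theorem tightGraph_le : tightGraph G w y ≤ G := fun _ _ h => h.1

/-- A permutation along `T` whose vector `permVec` saturates every vertex of `B`. -/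
structure IsSaturating (T : SimpleGraph V) (B : Set V) (σ : Equiv.Perm V) : Prop where
  movesAlong : MovesAlong T σ
  ne : ∀ u ∈ B, σ u ≠ u

variable [Fintype V]

/-- An optimal fractional cover: one whose value is attained by a fractional matching. -/
structure IsOptCover (G : SimpleGraph V) (w : Sym2 V → ℝ) (y : V → ℝ) : Prop
    extends IsFracCover G w y where
  attained : ∃ x ∈ fracMatchings G, ∑ v, y v ≤ fracWeight G w x

theorem IsFracCover.mul_nonneg (hy : IsFracCover G w y) {x : Sym2 V → ℝ}
    (hx : x ∈ fracMatchings G) (u v : V) : 0 ≤ (y u + y v - w s(u, v)) * x s(u, v) := by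
  rw [mem_fracMatchings_iff] at hx
  by_cases h : G.Adj u v
  · exact _root_.mul_nonneg (by linarith [hy.le_add u v h]) (hx.2.1 _)
  · rw [hx.1 _ h, mul_zero]

theorem IsFracCover.mul_slack_nonneg (hy : IsFracCover G w y) {x : Sym2 V → ℝ}
    (hx : x ∈ fracMatchings G) (u : V) : 0 ≤ y u * (1 - ∑ v, x s(u, v)) :=
  _root_.mul_nonneg (hy.nonneg u) (sub_nonneg.2 (((mem_fracMatchings_iff G x).1 hx).2.2 u))

theorem IsFracCover.fracWeight_le (hy : IsFracCover G w y) {x : Sym2 V → ℝ}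
    (hx : x ∈ fracMatchings G) : fracWeight G w x ≤ ∑ v, y v := by
  have hgap := sum_sub_fracWeight G w hx.1 y
  have hedge : 0 ≤ ∑ u, ∑ v, (y u + y v - w s(u, v)) * x s(u, v) :=
    Finset.sum_nonneg fun u _ => Finset.sum_nonneg fun v _ => hy.mul_nonneg hx u v
  have hvert := Finset.sum_nonneg fun u (_ : u ∈ Finset.univ) => hy.mul_slack_nonneg hx u
  linarith

/-- This is complementary slackness. -/
theorem IsFracCover.isSaturating_of_sum_le (hy : IsFracCover G w y) (hσ : MovesAlong G σ)
    (hmax : ∑ v, y v ≤ fracWeight G w (permVec σ)) :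
    IsSaturating (tightGraph G w y) {u | 0 < y u} σ := by
  have hx := hσ.permVec_mem_fracMatchings
  have hgap := sum_sub_fracWeight G w hx.1 y
  have hrow : ∀ u, 0 ≤ ∑ v, (y u + y v - w s(u, v)) * permVec σ s(u, v) := fun u =>
    Finset.sum_nonneg fun v _ => hy.mul_nonneg hx u v
  have hedge := Finset.sum_nonneg fun u (_ : u ∈ Finset.univ) => hrow u
  have hvert := Finset.sum_nonneg fun u (_ : u ∈ Finset.univ) => hy.mul_slack_nonneg hx u
  have hedge0 := (Finset.sum_eq_zero_iff_of_nonneg fun u _ => hrow u).1 (by linarith)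
  have hvert0 :=
    (Finset.sum_eq_zero_iff_of_nonneg fun u _ => hy.mul_slack_nonneg hx u).1 (by linarith)
  refine ⟨fun u => or_iff_not_imp_left.2 fun hu => ⟨(hσ u).resolve_left hu, ?_⟩,
    fun u hu hfix => ?_⟩
  · have h := (Finset.sum_eq_zero_iff_of_nonneg fun v _ => hy.mul_nonneg hx u v).1
      (hedge0 u (Finset.mem_univ u)) (σ u) (Finset.mem_univ _)
    linarith [(mul_eq_zero.1 h).resolve_right (permVec_ne_zero.2 ⟨Ne.symm hu, Or.inl rfl⟩)]
  · classical
    have h := hvert0 u (Finset.mem_univ u)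
    rw [sum_permVec, if_pos hfix] at h
    linarith [Set.mem_ofPred_eq ▸ hu]

theorem IsFracCover.fracWeight_permVec (hy : IsFracCover G w y)
    (hσ : IsSaturating (tightGraph G w y) {u | 0 < y u} σ) :
    fracWeight G w (permVec σ) = ∑ v, y v := by
  classical
  have hx := hσ.movesAlong.permVec_mem_fracMatchings
  have hgap := sum_sub_fracWeight G w (mem_fracMatchings_of_le tightGraph_le hx).1 y
  have hedge : ∑ u, ∑ v, (y u + y v - w s(u, v)) * permVec σ s(u, v) = 0 := by
    refine Finset.sum_eq_zero fun u _ => Finset.sum_eq_zero fun v _ => ?_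
    by_cases h : (tightGraph G w y).Adj u v
    · rw [h.2, sub_self, zero_mul]
    · rw [hx.1 _ h, mul_zero]
  have hvert : ∑ u, y u * (1 - ∑ v, permVec σ s(u, v)) = 0 := by
    refine Finset.sum_eq_zero fun u _ => ?_
    rw [sum_permVec]
    rcases (hy.nonneg u).eq_or_lt with h | h
    · rw [← h, zero_mul]
    · rw [if_neg (hσ.ne u h), sub_self, mul_zero]
  linarith

theorem IsFracCover.isOptCover_of_isSaturating (hy : IsFracCover G w y)
    (hσ : IsSaturating (tightGraph G w y) {u | 0 < y u} σ) : IsOptCover G w y :=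
  ⟨hy, permVec σ, (hσ.movesAlong.mono tightGraph_le).permVec_mem_fracMatchings,
    (hy.fracWeight_permVec hσ).ge⟩

theorem exists_isFracCover_forall_sum_le (G : SimpleGraph V) (w : Sym2 V → ℝ) :
    ∃ y, IsFracCover G w y ∧ ∀ z, IsFracCover G w z → ∑ v, y v ≤ ∑ v, z v := by
  classical
  have hconst : IsFracCover G w fun _ => ∑ e, |w e| := by
    have hpos : 0 ≤ ∑ e, |w e| := Finset.sum_nonneg fun e _ => abs_nonneg _
    refine ⟨fun _ => hpos, fun u v _ => ?_⟩
    have hle := Finset.single_le_sum (fun e _ => abs_nonneg (w e)) (Finset.mem_univ s(u, v))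
    linarith [le_abs_self (w s(u, v))]
  set c : ℝ := ∑ _v : V, ∑ e, |w e|
  have hcompact : IsCompact {y | IsFracCover G w y ∧ ∑ v, y v ≤ c} := by
    have hset : {y | IsFracCover G w y ∧ ∑ v, y v ≤ c} = ({y : V → ℝ | ∀ v, 0 ≤ y v} ∩
        {y | ∀ u v, G.Adj u v → w s(u, v) ≤ y u + y v}) ∩ {y | ∑ v, y v ≤ c} := by
      ext y
      exact and_congr_left' ⟨fun h => ⟨h.1, h.2⟩, fun h => ⟨h.1, h.2⟩⟩
    refine (isCompact_Icc (a := fun _ : V => (0 : ℝ)) (b := fun _ => c)).of_isClosed_subset ?_ ?_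
    · simp only [hset, Set.ofPred_forall]
      refine ((isClosed_iInter fun v => isClosed_le continuous_const (continuous_apply v)).inter
        (isClosed_iInter fun u => isClosed_iInter fun v => isClosed_iInter fun _ =>
          isClosed_le continuous_const (by fun_prop))).inter
        (isClosed_le (by fun_prop) continuous_const)
    · exact fun y hy => ⟨hy.1.nonneg, fun v => (Finset.single_le_sum (fun u _ => hy.1.nonneg u)
        (Finset.mem_univ v)).trans hy.2⟩
  obtain ⟨y, hy, hmin⟩ := hcompact.exists_isMinOn ⟨_, hconst, le_rfl⟩
    (f := fun y => ∑ v, y v) (by fun_prop)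
  refine ⟨y, hy.1, fun z hz => (le_total (∑ v, z v) c).elim (fun h => hmin ⟨hz, h⟩) hy.2.trans⟩

theorem eventually_nonneg_add_mul {a b : ℝ} (ha : 0 ≤ a) (hb : a = 0 → 0 ≤ b) :
    ∀ᶠ ε in nhdsWithin (0 : ℝ) (Set.Ioi 0), 0 ≤ a + ε * b := by
  rcases ha.eq_or_lt with rfl | ha
  · filter_upwards [self_mem_nhdsWithin] with ε hε
    simpa using mul_nonneg (le_of_lt hε) (hb rfl)
  · have hcont : Filter.Tendsto (fun ε => a + ε * b) (nhdsWithin 0 (Set.Ioi 0)) (nhds a) := by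
      have : Continuous fun ε : ℝ => a + ε * b := by fun_prop
      simpa using (this.tendsto 0).mono_left nhdsWithin_le_nhds
    exact (hcont.eventually_const_lt ha).mono fun _ => le_of_lt

/-- A set `S` violating Hall's condition for the tight edges yields a cheaper cover: lower the
values on `S` and raise them on its neighbours. -/
theorem IsFracCover.exists_sum_lt (hy : IsFracCover G w y) {S N : Finset V}
    (hN : ∀ u ∈ S, ∀ v, (tightGraph G w y).Adj u v → v ∈ N) (hS : ∀ u ∈ S, y u = 0 → u ∈ N)
    (hcard : N.card < S.card) : ∃ z, IsFracCover G w z ∧ ∑ v, z v < ∑ v, y v := by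
  classical
  let d : V → ℝ := fun v => (if v ∈ N then 1 else 0) - if v ∈ S then 1 else 0
  have hnonneg : ∀ v, ∀ᶠ ε in nhdsWithin (0 : ℝ) (Set.Ioi 0), 0 ≤ y v + ε * d v := fun v =>
    eventually_nonneg_add_mul (hy.nonneg v) fun hv => by
      have := hS v
      grind
  have hcover : ∀ u v, ∀ᶠ ε in nhdsWithin (0 : ℝ) (Set.Ioi 0),
      G.Adj u v → 0 ≤ (y u + y v - w s(u, v)) + ε * (d u + d v) := fun u v => by
    by_cases huv : G.Adj u v
    · refine (eventually_nonneg_add_mul (sub_nonneg.2 (hy.le_add u v huv)) fun h => ?_).mono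
        fun _ h _ => h
      have htight : (tightGraph G w y).Adj u v := ⟨huv, (sub_eq_zero.1 h).symm⟩
      have := fun hu => hN u hu v htight
      have := fun hv => hN v hv u htight.symm
      grind
    · exact Filter.Eventually.of_forall fun _ h => absurd h huv
  obtain ⟨ε, hn, hc, hε : 0 < ε⟩ := ((Filter.eventually_all.2 hnonneg).and
    ((Filter.eventually_all.2 fun u => Filter.eventually_all.2 (hcover u)).and
      self_mem_nhdsWithin)).exists
  have hd : ∑ v, d v = N.card - S.card := by simp [d]
  have hlt : (N.card : ℝ) < S.card := by exact_mod_cast hcard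
  refine ⟨fun v => y v + ε * d v, ⟨hn, fun u v huv => by linarith [hc u v huv]⟩, ?_⟩
  rw [Finset.sum_add_distrib, ← Finset.mul_sum, hd]
  nlinarith

/-- This combines strong duality with the half-integrality of optimal solutions. As in the Hungarian
method, the permutation is a Hall matching of the tight edges of a cheapest cover, where vertices
of value `0` may be matched to themselves. -/
theorem exists_isFracCover_isSaturating {V : Type*} [Finite V] (G : SimpleGraph V)
    (w : Sym2 V → ℝ) :
    ∃ y σ, IsFracCover G w y ∧ IsSaturating (tightGraph G w y) {u | 0 < y u} σ := by
  classical
  cases nonempty_fintype V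
  obtain ⟨y, hy, hmin⟩ := exists_isFracCover_forall_sum_le G w
  let t : V → Finset V := fun u =>
    Finset.univ.filter fun v => (tightGraph G w y).Adj u v ∨ v = u ∧ y u = 0
  have hhall : ∀ S : Finset V, S.card ≤ (S.biUnion t).card := fun S => by
    by_contra! hcard
    obtain ⟨z, hz, hlt⟩ := hy.exists_sum_lt (S := S) (N := S.biUnion t)
      (fun u hu v huv => Finset.mem_biUnion.2 ⟨u, hu, by simp [t, huv]⟩)
      (fun u hu h => Finset.mem_biUnion.2 ⟨u, hu, by simp [t, h]⟩) hcard
    exact (hmin z hz).not_gt hlt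
  obtain ⟨f, hinj, hf⟩ := (Finset.all_card_le_biUnion_card_iff_exists_injective t).1 hhall
  have hf' : ∀ u, (tightGraph G w y).Adj u (f u) ∨ f u = u ∧ y u = 0 := fun u => by
    simpa [t] using hf u
  refine ⟨y, Equiv.ofBijective f (Finite.injective_iff_bijective.1 hinj), hy,
    fun u => (hf' u).symm.imp_left And.left, fun u hu hfix => ?_⟩
  rcases hf' u with h | h
  · exact h.ne hfix.symm
  · exact hu.ne' h.2

theorem exists_isOptCover (G : SimpleGraph V) (w : Sym2 V → ℝ) : ∃ y, IsOptCover G w y := by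
  obtain ⟨y, σ, hy, hσ⟩ := exists_isFracCover_isSaturating G w
  exact ⟨y, hy.isOptCover_of_isSaturating hσ⟩

theorem IsOptCover.nuFrac_eq (hy : IsOptCover G w y) : nuFrac G w = ∑ v, y v := by
  obtain ⟨x, hx, hle⟩ := hy.attained
  refine IsGreatest.csSup_eq ⟨⟨x, hx, (hy.fracWeight_le hx).antisymm hle⟩, ?_⟩
  rintro _ ⟨z, hz, rfl⟩
  exact hy.fracWeight_le hz

end Duality

section Involutions

variable {V : Type*}

theorem exists_isolated_of_odd_card {S : Finset V} {r : V → V → Prop} (hr : ∀ a b, r a b → r b a)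
    (hS : Odd S.card) (h : ∀ c ∈ S, ∀ a ∈ S, ∀ b ∈ S, r c a → r c b → a ≠ c → b ≠ c → a = b) :
    ∃ c ∈ S, ∀ a ∈ S, r c a → a = c := by
  by_contra! hpair
  choose! g hgS hgr hgne using hpair
  have hsum : ∑ _c ∈ S, (1 : ZMod 2) = 0 :=
    Finset.sum_involution (fun c _ => g c) (fun _ _ => by decide) (fun c hc _ => hgne c hc) hgS
      fun c hc => h (g c) (hgS c hc) _ (hgS _ (hgS c hc)) c hc (hgr _ (hgS c hc))
        (hr _ _ (hgr c hc)) (hgne _ (hgS c hc)) (hgne c hc).symm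
  rw [Finset.sum_const, nsmul_one, ZMod.natCast_eq_zero_iff_even] at hsum
  exact Nat.not_even_iff_odd.2 hS hsum

variable {m n : Equiv.Perm V} {a b c : V}

theorem apply_zpow_mul_apply_of_left (hm : Function.Involutive m) (hn : Function.Involutive n)
    (hc : n c = c) (i : ℤ) : n (((n * m) ^ i) c) = ((n * m) ^ (-i)) c := by
  have hconj : n * (n * m) * n⁻¹ = (n * m)⁻¹ := by
    have hn' : n * n = 1 := Equiv.ext hn
    have hm' : m⁻¹ = m := inv_eq_of_mul_eq_one_right (Equiv.ext hm)
    rw [mul_inv_rev, hm', ← mul_assoc, hn', one_mul]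
  have hcomm : n * (n * m) ^ i = (n * m) ^ (-i) * n := by
    rw [← mul_inv_eq_iff_eq_mul, ← conj_zpow, hconj, inv_zpow, zpow_neg]
  rw [← Equiv.Perm.mul_apply, hcomm, Equiv.Perm.mul_apply, hc]

theorem apply_zpow_mul_apply_of_right (hm : Function.Involutive m) (hn : Function.Involutive n)
    (hc : n c = c) (i : ℤ) : m (((n * m) ^ i) c) = ((n * m) ^ (-i - 1)) c := by
  have h : n (((n * m) ^ (1 + i)) c) = m (((n * m) ^ i) c) := by
    rw [zpow_add, zpow_one, Equiv.Perm.mul_apply, Equiv.Perm.mul_apply, hn]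
  rw [← h, apply_zpow_mul_apply_of_left hm hn hc, neg_add_rev, sub_eq_add_neg]

theorem zpow_apply_eq_zpow_apply_iff {ρ : Equiv.Perm V} {i j : ℤ} :
    (ρ ^ i) c = (ρ ^ j) c ↔ (Function.minimalPeriod ρ c : ℤ) ∣ i - j := by
  have h : (ρ ^ i) c = (ρ ^ j) ((ρ ^ (i - j)) c) := by
    rw [← Equiv.Perm.mul_apply, ← zpow_add, add_sub_cancel]
  rw [h, (ρ ^ j).injective.eq_iff]
  exact MulAction.zpow_smul_eq_iff_minimalPeriod_dvd (a := ρ) (b := c)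

theorem zpow_mul_apply_fixed_left_iff (hm : Function.Involutive m) (hn : Function.Involutive n)
    (hc : n c = c) {i : ℤ} : n (((n * m) ^ i) c) = ((n * m) ^ i) c ↔
      (Function.minimalPeriod (n * m) c : ℤ) ∣ 2 * i := by
  rw [apply_zpow_mul_apply_of_left hm hn hc, zpow_apply_eq_zpow_apply_iff, ← dvd_neg]
  ring_nf

theorem zpow_mul_apply_fixed_right_iff (hm : Function.Involutive m) (hn : Function.Involutive n)
    (hc : n c = c) {i : ℤ} : m (((n * m) ^ i) c) = ((n * m) ^ i) c ↔
      (Function.minimalPeriod (n * m) c : ℤ) ∣ 2 * i + 1 := by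
  rw [apply_zpow_mul_apply_of_right hm hn hc, zpow_apply_eq_zpow_apply_iff, ← dvd_neg]
  ring_nf

/-- The orbits of two involutions are paths and cycles, so at most two points of an orbit are fixed
by `n`. -/
theorem eq_of_sameCycle_mul_of_ne (hm : Function.Involutive m) (hn : Function.Involutive n)
    (hc : n c = c) (ha : n a = a) (hb : n b = b) (hca : (n * m).SameCycle c a)
    (hcb : (n * m).SameCycle c b) (hac : a ≠ c) (hbc : b ≠ c) : a = b := by
  obtain ⟨i, rfl⟩ := hca
  obtain ⟨j, rfl⟩ := hcb
  have hne : ∀ k : ℤ, ((n * m) ^ k) c ≠ c → ¬(Function.minimalPeriod (n * m) c : ℤ) ∣ k :=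
    fun k hk hdvd => hk (by
      simpa using zpow_apply_eq_zpow_apply_iff.2 (show (_ : ℤ) ∣ k - 0 by rwa [sub_zero]))
  obtain ⟨k, hk⟩ := (zpow_mul_apply_fixed_left_iff hm hn hc).1 ha
  obtain ⟨l, hl⟩ := (zpow_mul_apply_fixed_left_iff hm hn hc).1 hb
  have hodd : ∀ {i k : ℤ}, ¬(Function.minimalPeriod (n * m) c : ℤ) ∣ i →
      2 * i = Function.minimalPeriod (n * m) c * k → Odd k := fun hi hik => by
    by_contra hk
    obtain ⟨q, rfl⟩ := Int.not_odd_iff_even.1 hk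
    exact hi ⟨q, by linarith⟩
  obtain ⟨q, hq⟩ := (hodd (hne i hac) hk).sub_odd (hodd (hne j hbc) hl)
  refine zpow_apply_eq_zpow_apply_iff.2 ⟨q, mul_left_cancel₀ (two_ne_zero' ℤ) ?_⟩
  linear_combination hk - hl + (Function.minimalPeriod (n * m) c : ℤ) * hq

theorem eq_of_sameCycle_mul_of_fixed (hm : Function.Involutive m) (hn : Function.Involutive n)
    (hc : n c = c) (ha : n a = a) (hb : m b = b) (hca : (n * m).SameCycle c a)
    (hcb : (n * m).SameCycle c b) : a = c := by
  obtain ⟨i, rfl⟩ := hca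
  obtain ⟨j, rfl⟩ := hcb
  have hi := (zpow_mul_apply_fixed_left_iff hm hn hc).1 ha
  have hj := (zpow_mul_apply_fixed_right_iff hm hn hc).1 hb
  have hcop : IsCoprime (Function.minimalPeriod (n * m) c : ℤ) 2 :=
    IsCoprime.of_isCoprime_of_dvd_left ⟨1, -j, by ring⟩ hj
  have h := zpow_apply_eq_zpow_apply_iff.2
    (show (_ : ℤ) ∣ i - 0 by rw [sub_zero]; exact hcop.dvd_of_dvd_mul_left hi)
  rwa [zpow_zero] at h

theorem sameCycle_mul_apply_left (hm : Function.Involutive m) (hn : Function.Involutive n)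
    (hc : n c = c) (h : (n * m).SameCycle c a) : (n * m).SameCycle c (n a) := by
  obtain ⟨i, rfl⟩ := h
  exact ⟨-i, (apply_zpow_mul_apply_of_left hm hn hc i).symm⟩

theorem sameCycle_mul_apply_right (hm : Function.Involutive m) (hn : Function.Involutive n)
    (hc : n c = c) (h : (n * m).SameCycle c a) : (n * m).SameCycle c (m a) := by
  obtain ⟨i, rfl⟩ := h
  exact ⟨-i - 1, (apply_zpow_mul_apply_of_right hm hn hc i).symm⟩

end Involutions

section Dissolving

variable {V : Type*} {σ : Equiv.Perm V} {R : Set V} {r u v : V}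

open Classical in
/-- The number of steps that `σ` takes from `u` to the set `R` (and `0` if it never gets there). -/
noncomputable def stepsTo (σ : Equiv.Perm V) (R : Set V) (u : V) : ℕ :=
  if h : ∃ k, σ^[k] u ∈ R then Nat.find h else 0

theorem stepsTo_eq_zero (hu : u ∈ R) : stepsTo σ R u = 0 := by
  classical
  have h : ∃ k, σ^[k] u ∈ R := ⟨0, hu⟩
  rw [stepsTo, dif_pos h, Nat.find_eq_zero]
  exact hu

theorem stepsTo_eq_succ (h : ∃ k, σ^[k] u ∈ R) (hu : u ∉ R) :
    stepsTo σ R u = stepsTo σ R (σ u) + 1 := by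
  classical
  obtain ⟨k, hk⟩ := h
  obtain ⟨k, rfl⟩ := Nat.exists_eq_succ_of_ne_zero (show k ≠ 0 by rintro rfl; exact hu hk)
  have h : ∃ k, σ^[k] u ∈ R := ⟨_, hk⟩
  have h' : ∃ k, σ^[k] (σ u) ∈ R := ⟨k, hk⟩
  rw [stepsTo, stepsTo, dif_pos h, dif_pos h']
  exact Nat.find_comp_succ h h' hu

theorem stepsTo_apply_add_one [Finite V] (hR : R.Pairwise fun r s => ¬σ.SameCycle r s)
    (hr : r ∈ R) : stepsTo σ R (σ r) + 1 = Function.minimalPeriod σ r := by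
  classical
  have hpos : 0 < Function.minimalPeriod σ r :=
    Function.minimalPeriod_pos_of_mem_periodicPts (σ.injective.mem_periodicPts r)
  have hmem : ∀ k, σ^[k] (σ r) ∈ R ↔ Function.minimalPeriod σ r ∣ k + 1 := fun k => by
    rw [← Function.iterate_succ_apply, ← Function.isPeriodicPt_iff_minimalPeriod_dvd]
    refine ⟨fun hk => by_contra fun hne => hR hr hk (Ne.symm hne) ⟨(k + 1 : ℕ), ?_⟩,
      fun hk => by rwa [hk.eq]⟩
    rw [zpow_natCast, Equiv.Perm.iterate_eq_pow]
  have h : ∃ k, σ^[k] (σ r) ∈ R :=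
    ⟨Function.minimalPeriod σ r - 1, (hmem _).2 (by rw [Nat.sub_add_cancel hpos])⟩
  have hle : Nat.find h ≤ Function.minimalPeriod σ r - 1 :=
    Nat.find_min' h ((hmem _).2 (by rw [Nat.sub_add_cancel hpos]))
  have hge := Nat.le_of_dvd (Nat.succ_pos _) ((hmem _).1 (Nat.find_spec h))
  rw [stepsTo, dif_pos h]
  omega

open Classical in
/-- The map that pairs up consecutive vertices of the cycles of `σ` through points of `R`, leaving
out the point of `R` if the cycle is odd, and agrees with `σ` on all other cycles. -/
noncomputable def dissolveFun (σ : Equiv.Perm V) (R : Set V) (u : V) : V :=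
  if Odd (stepsTo σ R u) then σ.symm u
  else if u ∈ R ∧ Odd (Function.minimalPeriod σ u) then u else σ u

theorem dissolveFun_dissolveFun [Finite V] (hR : R.Pairwise fun r s => ¬σ.SameCycle r s)
    (hu : ∃ k, σ^[k] u ∈ R) : dissolveFun σ R (dissolveFun σ R u) = u := by
  have hback : ∀ v, (∃ k, σ^[k] (σ v) ∈ R) → Odd (stepsTo σ R (σ v)) → dissolveFun σ R v = σ v := by
    rintro v ⟨k, hk⟩ hodd
    by_cases hv : v ∈ R
    · have hL := stepsTo_apply_add_one hR hv
      rw [dissolveFun, stepsTo_eq_zero hv, if_neg (by decide), if_neg]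
      rw [← hL]
      grind
    · have hstep := stepsTo_eq_succ ⟨k + 1, hk⟩ hv
      rw [dissolveFun, if_neg (by grind), if_neg fun h => hv h.1]
  by_cases hodd : Odd (stepsTo σ R u)
  · rw [dissolveFun.eq_1 σ R u, if_pos hodd, hback _ (by simpa) (by simpa), σ.apply_symm_apply]
  by_cases hfix : u ∈ R ∧ Odd (Function.minimalPeriod σ u)
  · have h : dissolveFun σ R u = u := by rw [dissolveFun, if_neg hodd, if_pos hfix]
    rw [h, h]
  · rw [dissolveFun.eq_1 σ R u, if_neg hodd, if_neg hfix, dissolveFun, if_pos, σ.symm_apply_apply]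
    by_cases hu' : u ∈ R
    · have hL := stepsTo_apply_add_one hR hu'
      grind
    · have hstep := stepsTo_eq_succ hu hu'
      grind

theorem dissolveFun_eq_self_iff : dissolveFun σ R u = u ↔
    σ u = u ∨ u ∈ R ∧ Odd (Function.minimalPeriod σ u) := by
  rw [dissolveFun]
  split_ifs with hodd hfix
  · rw [σ.symm_apply_eq, eq_comm, iff_self_or]
    exact fun h => by simp [stepsTo_eq_zero h.1] at hodd
  · simp [hfix]
  · simp [hfix]

theorem exists_iterate_mem_iff [Finite V] :
    (∃ k, σ^[k] u ∈ R) ↔ ∃ r ∈ R, σ.SameCycle r u := by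
  constructor
  · rintro ⟨k, hk⟩
    exact ⟨_, hk, Equiv.Perm.SameCycle.symm
      ⟨k, by rw [zpow_natCast, Equiv.Perm.iterate_eq_pow]⟩⟩
  · rintro ⟨r, hr, h⟩
    obtain ⟨k, hk⟩ := h.symm.exists_nat_pow_eq
    exact ⟨k, by rwa [Equiv.Perm.iterate_eq_pow, hk]⟩

theorem exists_perm_dissolving [Finite V] (hR : R.Pairwise fun r s => ¬σ.SameCycle r s) :
    ∃ τ : Equiv.Perm V, (∀ u, τ u = u ∨ τ u = σ u ∨ σ (τ u) = u) ∧
      (∀ u, τ u = u ↔ σ u = u ∨ u ∈ R ∧ Odd (Function.minimalPeriod σ u)) ∧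
      (∀ r ∈ R, ∀ u, σ.SameCycle r u → τ (τ u) = u) ∧
      ∀ u, (∀ r ∈ R, ¬σ.SameCycle r u) → τ u = σ u := by
  have hcases : ∀ u, dissolveFun σ R u = u ∨ dissolveFun σ R u = σ u ∨
      σ (dissolveFun σ R u) = u := fun u => by
    rw [dissolveFun]
    split_ifs <;> simp
  have hother : ∀ u, (∀ r ∈ R, ¬σ.SameCycle r u) → dissolveFun σ R u = σ u := fun u hu => by
    have hsteps : stepsTo σ R u = 0 :=
      dif_neg fun h => by
        obtain ⟨r, hr, hru⟩ := exists_iterate_mem_iff.1 h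
        exact hu r hr hru
    rw [dissolveFun, hsteps, if_neg (by decide), if_neg fun h => hu u h.1 (.refl σ u)]
  have hpair : ∀ r ∈ R, ∀ u, σ.SameCycle r u → dissolveFun σ R (dissolveFun σ R u) = u :=
    fun r hr u hru => dissolveFun_dissolveFun hR (exists_iterate_mem_iff.2 ⟨r, hr, hru⟩)
  have hsame : ∀ r u, σ.SameCycle r (dissolveFun σ R u) ↔ σ.SameCycle r u := fun r u => by
    rcases hcases u with h | h | h
    · rw [h]
    · rw [h, Equiv.Perm.sameCycle_apply_right]
    · rw [← Equiv.Perm.sameCycle_apply_right, h]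
  have hinj : Function.Injective (dissolveFun σ R) := fun u v huv => by
    have huv' : ∀ r, σ.SameCycle r u ↔ σ.SameCycle r v := fun r => by rw [← hsame, huv, hsame]
    by_cases h : ∃ r ∈ R, σ.SameCycle r u
    · obtain ⟨r, hr, hru⟩ := h
      rw [← hpair r hr u hru, huv, hpair r hr v ((huv' r).1 hru)]
    · push Not at h
      rw [hother u h, hother v fun r hr => mt (huv' r).2 (h r hr)] at huv
      exact σ.injective huv
  exact ⟨Equiv.ofBijective _ (Finite.injective_iff_bijective.1 hinj), hcases,
    fun u => dissolveFun_eq_self_iff, hpair, hother⟩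

end Dissolving

section Exchange

variable {V : Type*} {T : SimpleGraph V} {B P : Set V} {σ m : Equiv.Perm V} {u v : V}

theorem MovesAlong.of_forall_or {τ : Equiv.Perm V} (hσ : MovesAlong T σ)
    (h : ∀ u, τ u = u ∨ τ u = σ u ∨ σ (τ u) = u) : MovesAlong T τ := by
  intro u
  rcases h u with h | h | h
  · exact Or.inl h
  · exact h ▸ hσ u
  · have hadj := hσ (τ u)
    rw [h] at hadj
    exact hadj.imp Eq.symm SimpleGraph.Adj.symm

/-- The vertices on the cycles of `σ` of length at least three. -/
def longVerts (σ : Equiv.Perm V) : Set V := {u | σ (σ u) ≠ u}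

theorem mem_longVerts_iff_of_sameCycle (h : σ.SameCycle u v) :
    u ∈ longVerts σ ↔ v ∈ longVerts σ := by
  obtain ⟨i, rfl⟩ := h
  have hcomm : σ (σ ((σ ^ i) u)) = (σ ^ i) (σ (σ u)) :=
    DFunLike.congr_fun (((Commute.refl σ).mul_left (.refl σ)).zpow_right i).eq u
  rw [longVerts, Set.mem_ofPred_eq, Set.mem_ofPred_eq, hcomm, Ne, Ne, (σ ^ i).injective.eq_iff]

open Classical in
theorem exists_involutive_eq_of_notMem_longVerts (σ : Equiv.Perm V) :
    ∃ n : Equiv.Perm V, Function.Involutive n ∧ (∀ u ∉ longVerts σ, n u = σ u) ∧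
      ∀ u ∈ longVerts σ, n u = u := by
  have hinv : Function.Involutive fun u => if σ (σ u) = u then σ u else u := fun u => by
    by_cases h : σ (σ u) = u <;> simp [h]
  exact ⟨hinv.toPerm, hinv, fun u hu => if_pos (not_not.1 hu), fun u hu => if_neg hu⟩

variable [Finite V]

theorem apply_mem_iff_of_forall_mem (hσ : ∀ u ∈ P, σ u ∈ P) (u : V) : σ u ∈ P ↔ u ∈ P :=
  ⟨fun h => by simpa using Equiv.Perm.perm_symm_on_of_perm_on_finite (p := (· ∈ P)) hσ h, hσ u⟩

theorem exists_perm_piecewise {τ : Equiv.Perm V} (hτ : ∀ u ∈ P, τ u ∈ P) (hσ : ∀ u ∈ P, σ u ∈ P) :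
    ∃ π : Equiv.Perm V, (∀ u ∈ P, π u = τ u) ∧ ∀ u ∉ P, π u = σ u := by
  classical
  exact ⟨(τ.subtypePerm (p := (· ∈ P)) (apply_mem_iff_of_forall_mem hτ)).subtypeCongr
    (σ.subtypePerm (p := (· ∉ P)) fun u => not_congr (apply_mem_iff_of_forall_mem hσ u)),
    fun u hu => Equiv.Perm.subtypeCongr.left_apply _ _ hu,
    fun u hu => Equiv.Perm.subtypeCongr.right_apply _ _ hu⟩

theorem exists_finset_sameCycle (σ : Equiv.Perm V) (u : V) :
    ∃ S : Finset V, S.card = Function.minimalPeriod σ u ∧ ∀ v, v ∈ S ↔ σ.SameCycle u v := by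
  classical
  refine ⟨(Finset.range (Function.minimalPeriod σ u)).image fun k => σ^[k] u, ?_, fun v => ?_⟩
  · rw [Finset.card_image_of_injOn, Finset.card_range]
    simpa using Function.iterate_injOn_Iio_minimalPeriod (f := σ) (x := u)
  · simp only [Finset.mem_image, Finset.mem_range]
    constructor
    · rintro ⟨k, -, rfl⟩
      exact ⟨k, by rw [zpow_natCast, Equiv.Perm.iterate_eq_pow]⟩
    · intro h
      obtain ⟨k, rfl⟩ := h.exists_nat_pow_eq
      have hpos := Function.minimalPeriod_pos_of_mem_periodicPts (σ.injective.mem_periodicPts u)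
      exact ⟨k % _, Nat.mod_lt _ hpos, by
        rw [Function.iterate_mod_minimalPeriod_eq, Equiv.Perm.iterate_eq_pow]⟩

theorem IsSaturating.exists_augment (hσ : IsSaturating T B σ) (hmT : MovesAlong T m)
    (hm : Function.Involutive m) (hmP : ∀ u ∈ P, m u ∈ P)
    (hσP : ∀ u ∈ P, u ∉ longVerts σ → σ u ∈ P) (hmB : ∀ u ∈ P, m u = u → u ∉ B)
    (hodd : ∀ u ∈ longVerts σ, Odd (Function.minimalPeriod σ u))
    (hsep : (longVerts σ ∩ P).Pairwise fun u v => ¬σ.SameCycle u v) :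
    ∃ τ, IsSaturating T B τ ∧ longVerts τ ⊆ longVerts σ \ P := by
  obtain ⟨π, hπσ, hfix, -, hother⟩ := exists_perm_dissolving hsep
  have hshort : ∀ u ∉ longVerts σ, π u = σ u := fun u hu =>
    hother u fun r hr h => hu ((mem_longVerts_iff_of_sameCycle h).1 hr.1)
  have hπP : ∀ u ∈ P, π u ∈ P := fun u hu => by
    by_cases h : u ∈ longVerts σ
    · rwa [(hfix u).2 (Or.inr ⟨⟨h, hu⟩, hodd u h⟩)]
    · exact hshort u h ▸ hσP u hu h
  obtain ⟨τ, hτm, hτπ⟩ := exists_perm_piecewise hmP hπP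
  refine ⟨τ, ⟨fun u => ?_, fun u hu => ?_⟩, fun u hu => ?_⟩
  · by_cases h : u ∈ P
    · exact hτm u h ▸ hmT u
    · exact hτπ u h ▸ hσ.movesAlong.of_forall_or hπσ u
  · by_cases h : u ∈ P
    · exact hτm u h ▸ fun hu' => hmB u h hu' hu
    · rw [hτπ u h, Ne, hfix]
      exact not_or.2 ⟨hσ.ne u hu, fun h' => h h'.1.2⟩
  · have huP : u ∉ P := fun h => hu (by rw [hτm u h, hτm _ (hmP u h), hm])
    refine ⟨by_contra fun h => hu ?_, huP⟩
    have hσu : σ u ∉ longVerts σ :=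
      mt (mem_longVerts_iff_of_sameCycle (Equiv.Perm.sameCycle_apply_right.2 (.refl σ u))).2 h
    rw [hτπ u huP, hτπ _ (mt (apply_mem_iff_of_forall_mem hπP u).1 huP), hshort u h, hshort _ hσu,
      not_not.1 h]

theorem odd_minimalPeriod_of_minimalFor (hσ : MinimalFor (IsSaturating T B) longVerts σ)
    (hu : u ∈ longVerts σ) : Odd (Function.minimalPeriod σ u) := by
  by_contra heven
  obtain ⟨τ, hτσ, hfix, hpair, hother⟩ :=
    exists_perm_dissolving (σ := σ) (Set.pairwise_singleton u _)
  have hsat : IsSaturating T B τ := ⟨hσ.1.movesAlong.of_forall_or hτσ, fun v hv => by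
    rw [Ne, hfix]
    exact not_or.2 ⟨hσ.1.ne v hv, by rintro ⟨rfl, h⟩; exact heven h⟩⟩
  have hτu : u ∉ longVerts τ := not_not.2 (hpair u rfl u (.refl σ u))
  refine hτu (hσ.2 hsat (fun v hv => ?_) hu)
  have hv' : ¬σ.SameCycle u v := fun h => hv (hpair u rfl v h)
  have hσv : ¬σ.SameCycle u (σ v) := mt Equiv.Perm.sameCycle_apply_right.1 hv'
  rwa [longVerts, Set.mem_ofPred_eq, hother v (by rintro _ rfl; exact hv'),
    hother _ (by rintro _ rfl; exact hσv)] at hv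

/-- The components of the union of `m` and the matching part `n` of `σ` are paths and cycles, and
two vertices of a long cycle can only be joined by a path, as its two ends. An odd cycle is
thus left by the path from one of its vertices `c`; if that path ended in another odd cycle, or at
an uncovered vertex outside `B`, then `σ` could be augmented along it. -/
theorem exists_sameCycle_fixed_of_minimalFor {n : Equiv.Perm V}
    (hσ : MinimalFor (IsSaturating T B) longVerts σ) (hmT : MovesAlong T m)
    (hm : Function.Involutive m) (hn : Function.Involutive n)
    (hnσ : ∀ u ∉ longVerts σ, n u = σ u) (hn_fix : ∀ u ∈ longVerts σ, n u = u)
    (hu : u ∈ longVerts σ) :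
    ∃ c b, σ.SameCycle u c ∧ (n * m).SameCycle c b ∧ b ∈ B ∧ m b = b := by
  obtain ⟨S, hScard, hS⟩ := exists_finset_sameCycle σ u
  have hSlong : ∀ v ∈ S, v ∈ longVerts σ := fun v hv =>
    (mem_longVerts_iff_of_sameCycle ((hS v).1 hv)).1 hu
  obtain ⟨c, hcS, hc⟩ := exists_isolated_of_odd_card (S := S) (r := (n * m).SameCycle)
    (fun _ _ h => h.symm) (hScard ▸ odd_minimalPeriod_of_minimalFor hσ hu)
    fun c hcS a ha b hb => eq_of_sameCycle_mul_of_ne hm hn (hn_fix c (hSlong c hcS))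
      (hn_fix a (hSlong a ha)) (hn_fix b (hSlong b hb))
  have hcfix := hn_fix c (hSlong c hcS)
  by_contra! hno
  have hsep : (longVerts σ ∩ {v | (n * m).SameCycle c v}).Pairwise fun a b => ¬σ.SameCycle a b := by
    rintro a ⟨ha, hca⟩ b ⟨hb, hcb⟩ hab hσab
    have hne : ∀ {a b}, (n * m).SameCycle c b → σ.SameCycle a b → a ≠ b → a ≠ c := by
      rintro a b hcb hσ hne rfl
      exact hne (hc b ((hS b).2 (((hS a).1 hcS).trans hσ)) hcb).symm
    exact hab (eq_of_sameCycle_mul_of_ne hm hn hcfix (hn_fix a ha) (hn_fix b hb) hca hcb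
      (hne hcb hσab hab) (hne hca hσab.symm hab.symm))
  obtain ⟨τ, hτ, hle⟩ := hσ.1.exists_augment (P := {v | (n * m).SameCycle c v}) hmT hm
    (fun v hv => sameCycle_mul_apply_right hm hn hcfix hv)
    (fun v hv h => hnσ v h ▸ sameCycle_mul_apply_left hm hn hcfix hv)
    (fun v hv hmv hvB => hno c v ((hS c).1 hcS) hv hvB hmv)
    (fun v => odd_minimalPeriod_of_minimalFor hσ) hsep
  exact (hle (hσ.2 hτ (hle.trans Set.sdiff_subset) (hSlong c hcS))).2 (.refl (n * m) c)

theorem IsSaturating.exists_exchange (hσ : IsSaturating T B σ) (hmT : MovesAlong T m)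
    (hm : Function.Involutive m) :
    ∃ τ, IsSaturating T B τ ∧ (∀ u ∈ longVerts τ, Odd (Function.minimalPeriod τ u)) ∧
      ∃ f : V → V, (∀ u ∈ longVerts τ, f u ∈ B ∧ m (f u) = f u) ∧
        ∀ u ∈ longVerts τ, ∀ v ∈ longVerts τ, f u = f v → τ.SameCycle u v := by
  obtain ⟨τ, hτ⟩ := Set.Finite.exists_minimalFor longVerts _
    (Set.toFinite {τ | IsSaturating T B τ}) ⟨σ, hσ⟩
  obtain ⟨n, hn, hnτ, hn_fix⟩ := exists_involutive_eq_of_notMem_longVerts τ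
  choose! c f hc hf hfB hfix using fun u (hu : u ∈ longVerts τ) =>
    exists_sameCycle_fixed_of_minimalFor hτ hmT hm hn hnτ hn_fix hu
  refine ⟨τ, hτ.1, fun u => odd_minimalPeriod_of_minimalFor hτ, f,
    fun u hu => ⟨hfB u hu, hfix u hu⟩, fun u hu v hv huv => ?_⟩
  have hc_fix : ∀ u ∈ longVerts τ, n (c u) = c u := fun u hu =>
    hn_fix _ ((mem_longVerts_iff_of_sameCycle (hc u hu)).1 hu)
  have heq : c v = c u := eq_of_sameCycle_mul_of_fixed hm hn (hc_fix u hu) (hc_fix v hv)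
    (hfix u hu) ((hf u hu).trans (huv ▸ (hf v hv).symm)) (hf u hu)
  exact (hc u hu).trans (heq ▸ (hc v hv).symm)

end Exchange

section OddCycles

variable {V : Type*} {G : SimpleGraph V} {τ : Equiv.Perm V} {C D : G.Subgraph} {u : V}

theorem permVec_of_mem_longVerts (hu : u ∈ longVerts τ) : permVec τ s(u, τ u) = 1 / 2 := by
  rw [permVec_mk, if_neg fun h => hu (by rw [← h, ← h]), if_pos rfl, if_neg hu]
  norm_num

theorem permVec_of_apply_apply_eq (h : τ (τ u) = u) (h' : τ u ≠ u) : permVec τ s(u, τ u) = 1 := by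
  rw [permVec_mk, if_neg h'.symm, if_pos rfl, if_pos h]
  norm_num

theorem sameCycle_of_mem_support {v : V} (p : G.Walk u v) (hp : ∀ e ∈ p.edges, permVec τ e ≠ 0) :
    ∀ a ∈ p.support, τ.SameCycle u a := by
  induction p with
  | nil => intro a ha; rw [SimpleGraph.Walk.mem_support_nil_iff.1 ha]
  | @cons u u' v h q ih =>
    intro a ha
    rw [SimpleGraph.Walk.support_cons, List.mem_cons] at ha
    rcases ha with rfl | ha
    · rfl
    have hu' : τ.SameCycle u u' := by
      rcases (permVec_ne_zero.1 (hp s(u, u') (by simp))).2 with rfl | rfl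
      · exact Equiv.Perm.sameCycle_apply_right.2 (.refl τ u)
      · exact Equiv.Perm.sameCycle_apply_left.2 (.refl τ u')
    exact hu'.trans (ih (fun e he => hp e (by simp [he])) a ha)

theorem neighborSet_of_mem_oddCycles (hC : C ∈ oddCycles G (permVec τ)) (hu : u ∈ C.verts) :
    C.neighborSet u = {τ u, τ.symm u} ∧ u ∈ longVerts τ := by
  obtain ⟨v, p, hp, -, hhalf, rfl⟩ := hC
  rw [SimpleGraph.Walk.mem_verts_toSubgraph] at hu
  have hcard := hp.ncard_neighborSet_toSubgraph_eq_two hu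
  have hsub : p.toSubgraph.neighborSet u ⊆ {τ u, τ.symm u} := fun b hb => by
    have hval := hhalf s(u, b) ((SimpleGraph.Walk.mem_edges_toSubgraph p).1 hb)
    rcases (permVec_ne_zero.1 (by rw [hval]; norm_num)).2 with h | h
    · exact Or.inl h.symm
    · exact Or.inr (by rw [Set.mem_singleton_iff, ← h, Equiv.symm_apply_apply])
  have hle : ({τ u, τ.symm u} : Set V).ncard ≤ 2 :=
    (Set.ncard_insert_le _ _).trans (by rw [Set.ncard_singleton])
  have heq := Set.eq_of_subset_of_ncard_le hsub (hcard.symm ▸ hle) (Set.toFinite _)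
  refine ⟨heq, fun h => ?_⟩
  rw [heq, Equiv.eq_symm_apply τ |>.2 h, Set.pair_eq_singleton, Set.ncard_singleton] at hcard
  exact absurd hcard (by decide)

theorem mem_verts_iff_of_mem_oddCycles [Finite V] (hC : C ∈ oddCycles G (permVec τ))
    (hu : u ∈ C.verts) (a : V) : a ∈ C.verts ↔ τ.SameCycle u a := by
  constructor
  · obtain ⟨v, p, -, -, hhalf, rfl⟩ := hC
    rw [SimpleGraph.Walk.mem_verts_toSubgraph] at hu ⊢
    have h := sameCycle_of_mem_support p fun e he => by rw [hhalf e he]; norm_num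
    exact fun ha => (h u hu).symm.trans (h a ha)
  · intro h
    obtain ⟨i, rfl⟩ := h.exists_nat_pow_eq
    induction i with
    | zero => exact hu
    | succ i ih =>
      have hv := ih ⟨i, by rw [zpow_natCast]⟩
      have hmem : τ ((τ ^ i) u) ∈ C.neighborSet ((τ ^ i) u) :=
        (neighborSet_of_mem_oddCycles hC hv).1 ▸ Or.inl rfl
      rw [pow_succ', Equiv.Perm.mul_apply]
      exact C.edge_vert (C.adj_symm hmem)

theorem eq_of_mem_oddCycles [Finite V] (hC : C ∈ oddCycles G (permVec τ))
    (hD : D ∈ oddCycles G (permVec τ)) (huC : u ∈ C.verts) (huD : u ∈ D.verts) : C = D := by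
  have hv : ∀ a, a ∈ C.verts ↔ a ∈ D.verts := fun a => by
    rw [mem_verts_iff_of_mem_oddCycles hC huC, mem_verts_iff_of_mem_oddCycles hD huD]
  have hnbr : ∀ a ∈ C.verts, C.neighborSet a = D.neighborSet a := fun a ha => by
    rw [(neighborSet_of_mem_oddCycles hC ha).1,
      (neighborSet_of_mem_oddCycles hD ((hv a).1 ha)).1]
  refine SimpleGraph.Subgraph.ext (Set.ext hv) (funext₂ fun a b => propext ?_)
  exact ⟨fun h => (hnbr a (C.edge_vert h)).subset h,
    fun h => (hnbr a ((hv a).2 (D.edge_vert h))).superset h⟩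

theorem ncard_oddCycles_le [Finite V] {S : Set V} {f : V → V} (hf : ∀ u ∈ longVerts τ, f u ∈ S)
    (hinj : ∀ u ∈ longVerts τ, ∀ v ∈ longVerts τ, f u = f v → τ.SameCycle u v) :
    (oddCycles G (permVec τ)).ncard ≤ S.ncard := by
  have hex : ∀ C ∈ oddCycles G (permVec τ), ∃ u, u ∈ C.verts ∧ u ∈ longVerts τ := by
    rintro C hC
    obtain ⟨u, p, -, -, -, hCp⟩ := id hC
    have hu : u ∈ C.verts := by simp [hCp]
    exact ⟨u, hu, (neighborSet_of_mem_oddCycles hC hu).2⟩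
  choose g hgC hg using fun C : oddCycles G (permVec τ) => hex C C.2
  rw [← Nat.card_coe_set_eq, ← Nat.card_coe_set_eq]
  refine Nat.card_le_card_of_injective (fun C => (⟨f (g C), hf _ (hg C)⟩ : S)) fun C D h => ?_
  have hsame := hinj _ (hg C) _ (hg D) (Subtype.ext_iff.1 h)
  exact Subtype.ext (eq_of_mem_oddCycles C.2 D.2 (hgC C)
    ((mem_verts_iff_of_mem_oddCycles D.2 (hgC D) _).2 hsame.symm))

theorem exists_minimalPeriod_eq_add_three (hu : u ∈ longVerts τ)
    (hodd : Odd (Function.minimalPeriod τ u)) : ∃ k, Function.minimalPeriod τ u = k + 3 := by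
  have hne : Function.minimalPeriod τ u ≠ 1 := fun h => by
    have hfix : τ u = u := Function.minimalPeriod_eq_one_iff_isFixedPt.1 h
    exact hu (by rw [hfix, hfix])
  obtain ⟨j, hj⟩ := hodd
  exact ⟨2 * j - 2, by omega⟩

theorem exists_mem_oddCycles (hτ : MovesAlong G τ) (hu : u ∈ longVerts τ)
    (hodd : Odd (Function.minimalPeriod τ u)) : ∃ C ∈ oddCycles G (permVec τ), u ∈ C.verts := by
  obtain ⟨k, hk⟩ := exists_minimalPeriod_eq_add_three hu hodd
  let f : Fin (k + 3) → V := fun i => τ^[i] u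
  have hf : Function.Injective f := fun i j hij =>
    Fin.ext (Function.iterate_injOn_Iio_minimalPeriod (Set.mem_Iio.2 (i.2.trans_eq hk.symm))
      (Set.mem_Iio.2 (j.2.trans_eq hk.symm)) hij)
  have hsucc : ∀ i, f (i + 1) = τ (f i) := fun i => by
    have hval : ((i + 1 : Fin (k + 3)) : ℕ) = (i + 1) % Function.minimalPeriod τ u := by
      rw [hk, Fin.val_add, Fin.val_one]
    rw [← Function.iterate_succ_apply' τ, ← Function.iterate_mod_minimalPeriod_eq, ← hval]
  have hlong : ∀ i, f i ∈ longVerts τ := fun i =>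
    (mem_longVerts_iff_of_sameCycle ⟨i, by rw [zpow_natCast, ← Equiv.Perm.iterate_eq_pow]⟩).1 hu
  have hstep : ∀ {i j}, (SimpleGraph.cycleGraph (k + 3)).Adj i j →
      f i = τ (f j) ∨ f j = τ (f i) := fun {i j} hij => by
    rw [← hsucc, ← hsucc]
    exact (SimpleGraph.cycleGraph_adj.1 hij).imp (fun h => by rw [← h, add_sub_cancel])
      fun h => by rw [← h, add_sub_cancel]
  have hval : ∀ {i j}, f j = τ (f i) → permVec τ s(f i, f j) = 1 / 2 := fun {i j} h => by
    rw [h, permVec_of_mem_longVerts (hlong i)]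
  have hadj : ∀ i, G.Adj (f i) (τ (f i)) := fun i =>
    (hτ _).resolve_left fun h => hlong i (by rw [h, h])
  let φ : SimpleGraph.cycleGraph (k + 3) →g G := ⟨f, fun {i j} hij =>
    (hstep hij).elim (fun h => by rw [h]; exact (hadj j).symm) fun h => by rw [h]; exact hadj i⟩
  let p := (SimpleGraph.cycleGraph.cycle k).map φ
  have hp : p.IsCycle := SimpleGraph.cycleGraph.isCycle_cycle.map hf
  refine ⟨p.toSubgraph, ⟨_, p, hp, ?_, fun e he => ?_, rfl⟩,
    p.start_mem_verts_toSubgraph⟩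
  · rw [SimpleGraph.Walk.length_map, SimpleGraph.cycleGraph.length_cycle, ← hk]
    exact hodd
  · rw [SimpleGraph.Walk.edges_map, List.mem_map] at he
    obtain ⟨e, he, rfl⟩ := he
    induction e with
    | _ i j =>
      rcases hstep (SimpleGraph.Walk.adj_of_mem_edges _ he) with h | h
      · rw [Sym2.eq_swap]
        exact hval h
      · exact hval h

theorem sum_eq_of_permVec_eq_zero [Fintype V] {x : Sym2 V → ℝ}
    (hx : ∀ e, permVec τ e = 0 → x e = 0) (hu : u ∈ longVerts τ) :
    ∑ v, x s(τ u, v) = x s(τ u, τ (τ u)) + x s(u, τ u) := by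
  classical
  rw [Sym2.eq_swap (a := u), ← Finset.sum_pair (f := fun v => x s(τ u, v)) hu]
  refine (Finset.sum_subset (Finset.subset_univ _) fun v _ hv => ?_).symm
  refine hx _ (by_contra fun h => hv ?_)
  rcases (permVec_ne_zero.1 h).2 with h | h
  · simp [← h]
  · simp [τ.injective h]

theorem eq_permVec_of_sum_eq_one [Fintype V] {x : Sym2 V → ℝ}
    (hodd : ∀ u ∈ longVerts τ, Odd (Function.minimalPeriod τ u))
    (hx : ∀ e, permVec τ e = 0 → x e = 0) (hsum : ∀ u, τ u ≠ u → ∑ v, x s(u, v) = 1) :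
    x = permVec τ := by
  have hmatch : ∀ u, τ u ≠ u → τ (τ u) = u → x s(u, τ u) = 1 := fun u hu hττ => by
    rw [← hsum u hu]
    refine (Finset.sum_eq_single _ (fun v _ hv => hx _ (by_contra fun h => hv ?_)) (by simp)).symm
    rcases (permVec_ne_zero.1 h).2 with h | h
    · exact h.symm
    · exact τ.injective (h.trans hττ.symm)
  have hhalf : ∀ u ∈ longVerts τ, x s(u, τ u) = 1 / 2 := fun u hu => by
    have halt : ∀ i, x s(τ^[i] u, τ (τ^[i] u)) =
        if Even i then x s(u, τ u) else 1 - x s(u, τ u) := fun i => by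
      induction i with
      | zero => simp
      | succ i ih =>
        have hi : τ^[i] u ∈ longVerts τ := (mem_longVerts_iff_of_sameCycle
          ⟨i, by rw [zpow_natCast, ← Equiv.Perm.iterate_eq_pow]⟩).1 hu
        have hrow := hsum (τ (τ^[i] u)) fun h => hi (by rw [h, τ.injective h])
        rw [sum_eq_of_permVec_eq_zero hx hi, ih] at hrow
        rw [Function.iterate_succ_apply']
        simp only [Nat.even_add_one]
        split_ifs at hrow ⊢ <;> linarith
    have hper := halt (Function.minimalPeriod τ u)
    rw [Function.iterate_minimalPeriod, if_neg (Nat.not_even_iff_odd.2 (hodd u hu))] at hper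
    linarith
  have hedge : ∀ u, τ u ≠ u → x s(u, τ u) = permVec τ s(u, τ u) := fun u hu => by
    by_cases h : τ (τ u) = u
    · rw [hmatch u hu h, permVec_of_apply_apply_eq h hu]
    · rw [hhalf u h, permVec_of_mem_longVerts h]
  ext e
  by_cases he : permVec τ e = 0
  · rw [he, hx e he]
  induction e with
  | _ a b =>
    obtain ⟨hab, rfl | rfl⟩ := permVec_ne_zero.1 he
    · exact hedge a hab.symm
    · rw [Sym2.eq_swap]
      exact hedge b hab

theorem MovesAlong.permVec_mem_extremePoints [Fintype V] (hτ : MovesAlong G τ)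
    (hodd : ∀ u ∈ longVerts τ, Odd (Function.minimalPeriod τ u)) :
    permVec τ ∈ Set.extremePoints ℝ (fracMatchings G) := by
  classical
  rw [mem_extremePoints_iff_left]
  refine ⟨hτ.permVec_mem_fracMatchings, ?_⟩
  rintro x hx z hz ⟨s, t, hs, ht, hst, hxz⟩
  rw [mem_fracMatchings_iff] at hx hz
  have hval : ∀ e, s * x e + t * z e = permVec τ e := fun e => congrFun hxz e
  refine eq_permVec_of_sum_eq_one hodd (fun e he => ?_) fun u hu => ?_
  · have hxe := mul_nonneg hs.le (hx.2.1 e)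
    have hze := mul_nonneg ht.le (hz.2.1 e)
    exact (mul_eq_zero.1 (show s * x e = 0 by linarith [hval e])).resolve_left hs.ne'
  · have hsum : s * ∑ v, x s(u, v) + t * ∑ v, z s(u, v) = 1 := by
      rw [Finset.mul_sum, Finset.mul_sum, ← Finset.sum_add_distrib,
        Finset.sum_congr rfl fun v _ => hval s(u, v), sum_permVec, if_neg hu]
    nlinarith [hx.2.2 u, mul_le_mul_of_nonneg_left (hz.2.2 u) ht.le]

end OddCycles

section CommonCover

variable {V : Type*} {G : SimpleGraph V} {w : Sym2 V → ℝ} {y : V → ℝ}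

theorem MovesAlong.deleteIncidenceSet {σ : Equiv.Perm V} {v : V} (hσ : MovesAlong G σ)
    (hv : σ v = v) : MovesAlong (G.deleteIncidenceSet v) σ := fun u => by
  by_cases hu : σ u = u
  · exact Or.inl hu
  · have hne : u ≠ v := fun h => hu (by rw [h, hv])
    refine (hσ u).imp_right fun h => SimpleGraph.deleteIncidenceSet_adj.2 ⟨h, hne, fun h => ?_⟩
    exact hne (σ.injective (h.trans hv.symm))

theorem IsFracCover.update_zero [DecidableEq V] (hy : IsFracCover G w y) (v : V) :
    IsFracCover (G.deleteIncidenceSet v) w (Function.update y v 0) where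
  nonneg u := by
    rw [Function.update_apply]
    split_ifs
    exacts [le_rfl, hy.nonneg u]
  le_add a b h := by
    obtain ⟨hab, ha, hb⟩ := SimpleGraph.deleteIncidenceSet_adj.1 h
    rw [Function.update_of_ne ha, Function.update_of_ne hb]
    exact hy.le_add a b hab

variable [Fintype V]

theorem fracWeight_le_nuFrac {x : Sym2 V → ℝ} (hx : x ∈ fracMatchings G) :
    fracWeight G w x ≤ nuFrac G w := by
  obtain ⟨y, hy⟩ := exists_isOptCover G w
  rw [hy.nuFrac_eq]
  exact hy.fracWeight_le hx

theorem nuFrac_mono {H : SimpleGraph V} (h : H ≤ G) (w : Sym2 V → ℝ) :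
    nuFrac H w ≤ nuFrac G w := by
  obtain ⟨y, hy⟩ := exists_isOptCover H w
  obtain ⟨x, hx, hle⟩ := hy.attained
  rw [hy.nuFrac_eq]
  refine hle.trans ?_
  rw [← fracWeight_eq_of_le w h hx.1]
  exact fracWeight_le_nuFrac (mem_fracMatchings_of_le h hx)

theorem IsFracCover.isOptCover_of_sum_le (hy : IsFracCover G w y)
    (hle : ∑ v, y v ≤ nuFrac G w) : IsOptCover G w y := by
  obtain ⟨z, hz⟩ := exists_isOptCover G w
  obtain ⟨x, hx, hzx⟩ := hz.attained
  exact ⟨hy, x, hx, hle.trans (hz.nuFrac_eq.trans_le hzx)⟩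

theorem fracWeight_sub_ite_mem [DecidableEq V] {x : Sym2 V → ℝ}
    (hx : ∀ e, e ∉ G.edgeSet → x e = 0) (v : V) (g : ℝ) :
    fracWeight G (fun e => w e - if v ∈ e then g else 0) x =
      fracWeight G w x - g * ∑ u, x s(v, u) := by
  classical
  rw [← sum_incidenceFinset G hx, SimpleGraph.incidenceFinset_eq_filter, Finset.sum_filter,
    Finset.mul_sum, fracWeight, fracWeight, ← Finset.sum_sub_distrib]
  refine Finset.sum_congr rfl fun e _ => ?_
  by_cases h : v ∈ e
  · rw [if_pos h, if_pos h, sub_mul]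
  · rw [if_neg h, if_neg h, sub_zero, mul_zero, sub_zero]

/-- Lowering the weights of the edges at `v` by the loss `g = ν_f(G) - ν_f(G - v)` makes it
irrelevant whether `v` is used; an optimal cover for the lowered weights, raised by `g` at `v`, is
then optimal for `G`, and optimal for `G - v` once the value at `v` is dropped. -/
theorem exists_common_isOptCover [DecidableEq V] (G : SimpleGraph V) (w : Sym2 V → ℝ) (v : V) :
    ∃ y, IsOptCover G w y ∧ IsOptCover (G.deleteIncidenceSet v) w (Function.update y v 0) := by
  have hdel : G.deleteIncidenceSet v ≤ G := G.deleteIncidenceSet_le v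
  set g := nuFrac G w - nuFrac (G.deleteIncidenceSet v) w
  have hg0 : 0 ≤ g := sub_nonneg.2 (nuFrac_mono hdel w)
  obtain ⟨y, σ, hy, hσ⟩ :=
    exists_isFracCover_isSaturating G fun e => w e - if v ∈ e then g else 0
  have hσG := hσ.movesAlong.mono tightGraph_le
  have hmem := hσG.permVec_mem_fracMatchings
  have hsum : ∑ u, y u ≤ nuFrac (G.deleteIncidenceSet v) w := by
    rw [← hy.fracWeight_permVec hσ, fracWeight_sub_ite_mem hmem.1, sum_permVec]
    split_ifs with hv
    · have hmem' := (hσG.deleteIncidenceSet hv).permVec_mem_fracMatchings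
      rw [fracWeight_eq_of_le w hdel hmem'.1, mul_zero, sub_zero]
      exact fracWeight_le_nuFrac hmem'
    · linarith [fracWeight_le_nuFrac (w := w) hmem]
  have hsingle : 0 ≤ (Pi.single v g : V → ℝ) := Pi.single_nonneg.2 hg0
  have hz : IsFracCover G w (y + Pi.single v g) := by
    refine ⟨fun u => add_nonneg (hy.nonneg u) (hsingle u), fun a b hab => ?_⟩
    have hle := hy.le_add a b hab
    have hne := hab.ne
    simp only [Pi.add_apply, Pi.single_apply, Sym2.mem_iff] at hle ⊢
    grind
  refine ⟨_, hz.isOptCover_of_sum_le ?_, (hz.update_zero v).isOptCover_of_sum_le ?_⟩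
  · simp only [Pi.add_apply, Finset.sum_add_distrib, Finset.sum_pi_single', Finset.mem_univ,
      if_true]
    linarith
  · refine le_trans (Finset.sum_le_sum fun u _ => ?_) hsum
    rw [Function.update_apply]
    split_ifs with hu
    · exact hy.nonneg u
    · simp [hu]

end CommonCover

section Gamma

variable {V : Type*} {G : SimpleGraph V} {w : Sym2 V → ℝ} {y : V → ℝ} {σ m : Equiv.Perm V}

theorem tightGraph_deleteIncidenceSet [DecidableEq V] (v : V) :
    tightGraph (G.deleteIncidenceSet v) w (Function.update y v 0) =
      (tightGraph G w y).deleteIncidenceSet v := by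
  ext a b
  simp only [tightGraph, SimpleGraph.deleteIncidenceSet_adj, Function.update_apply]
  grind

theorem mem_longVerts_of_odd_minimalPeriod {u : V} (hu : σ u ≠ u)
    (hodd : Odd (Function.minimalPeriod σ u)) : u ∈ longVerts σ := fun h => hu <| by
  have hdvd : Function.minimalPeriod σ u ∣ 2 :=
    Function.IsPeriodicPt.minimalPeriod_dvd (f := σ) (n := 2) h
  rcases (Nat.dvd_prime Nat.prime_two).1 hdvd with h1 | h2
  · exact Function.minimalPeriod_eq_one_iff_isFixedPt.1 h1
  · rw [h2] at hodd
    exact absurd hodd (by decide)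

theorem exists_involutive_odd_of_fixed [Finite V] (σ : Equiv.Perm V) :
    ∃ m : Equiv.Perm V, Function.Involutive m ∧ (∀ u, m u = u ∨ m u = σ u ∨ σ (m u) = u) ∧
      (∀ u, m u = u → σ u = u ∨ Odd (Function.minimalPeriod σ u)) ∧
      ∀ u v, m u = u → m v = v → σ.SameCycle u v → σ u = u ∨ u = v := by
  let rep : Quotient (Equiv.Perm.SameCycle.setoid σ) → V := Quotient.out
  have hpair : (Set.range rep).Pairwise fun r s => ¬σ.SameCycle r s := by
    rintro _ ⟨q, rfl⟩ _ ⟨q', rfl⟩ hne h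
    exact hne (congrArg rep (Quotient.out_equiv_out.1 h))
  obtain ⟨m, hσ, hfix, hinv, -⟩ := exists_perm_dissolving hpair
  have hm : Function.Involutive m := fun u => hinv _ ⟨⟦u⟧, rfl⟩ u
    (Quotient.mk_out (s := Equiv.Perm.SameCycle.setoid σ) u)
  refine ⟨m, hm, hσ, fun u hu => ((hfix u).1 hu).imp_right And.right, fun u v hu hv h => ?_⟩
  refine ((hfix u).1 hu).imp_right fun hu => by_contra fun hne => ?_
  rcases (hfix v).1 hv with hv | hv
  · exact hne (h.eq_of_right hv)
  · exact hpair hu.1 hv.1 hne h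

theorem exists_involutive_fixing [Finite V] (hm : Function.Involutive m) (v : V) :
    ∃ m' : Equiv.Perm V, Function.Involutive m' ∧ m' v = v ∧ (∀ u, m' u = u ∨ m' u = m u) ∧
      ∀ u, m' u = u → m u = u ∨ u = v ∨ u = m v := by
  have hP : ∀ u ∈ ({v, m v} : Set V), m u ∈ ({v, m v} : Set V) := by
    rintro u (rfl | rfl) <;> simp [hm _]
  obtain ⟨m', hm'P, hm'⟩ := exists_perm_piecewise (τ := 1) (fun _ => id) hP
  refine ⟨m', fun u => ?_, hm'P v (Or.inl rfl), fun u => ?_, fun u hu => ?_⟩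
  · by_cases hu : u ∈ ({v, m v} : Set V)
    · exact (congrArg m' (hm'P u hu)).trans (hm'P u hu)
    · rw [hm' u hu, hm' _ (mt (apply_mem_iff_of_forall_mem hP u).1 hu), hm]
  · exact (em _).imp (hm'P u) (hm' u)
  · exact (em (u ∈ ({v, m v} : Set V))).symm.imp_left fun h => hm' u h ▸ hu

variable [Fintype V]

theorem IsOptCover.exists_isSaturating (hy : IsOptCover G w y) {x : Sym2 V → ℝ}
    (hx : x ∈ basicMaxFracMatchings G w) :
    ∃ σ, x = permVec σ ∧ IsSaturating (tightGraph G w y) {u | 0 < y u} σ := by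
  obtain ⟨σ, hσ, rfl⟩ := exists_perm_of_mem_extremePoints hx.1
  obtain ⟨x₀, hx₀, hle⟩ := hy.attained
  exact ⟨σ, rfl, hy.isSaturating_of_sum_le hσ (hle.trans (hx.2 x₀ hx₀))⟩

theorem IsOptCover.gamma_le (hy : IsOptCover G w y) (hmT : MovesAlong (tightGraph G w y) m)
    (hm : Function.Involutive m) : gamma G w ≤ {u | 0 < y u ∧ m u = u}.ncard := by
  obtain ⟨x, hx⟩ := basicMaxFracMatchings_nonempty G w
  obtain ⟨σ, -, hσ⟩ := hy.exists_isSaturating hx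
  obtain ⟨τ, hτ, hodd, f, hf, hinj⟩ := hσ.exists_exchange hmT hm
  have hmem : permVec τ ∈ basicMaxFracMatchings G w := by
    refine ⟨(hτ.movesAlong.mono tightGraph_le).permVec_mem_extremePoints hodd, fun z hz => ?_⟩
    rw [hy.fracWeight_permVec hτ]
    exact hy.fracWeight_le hz
  exact (Nat.sInf_le ⟨_, hmem, rfl⟩ : gamma G w ≤ _).trans (ncard_oddCycles_le hf hinj)

theorem IsOptCover.exists_involutive_ncard_le_gamma (hy : IsOptCover G w y) :
    ∃ m, MovesAlong (tightGraph G w y) m ∧ Function.Involutive m ∧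
      {u | 0 < y u ∧ m u = u}.ncard ≤ gamma G w := by
  obtain ⟨x, hx, hγ⟩ := Nat.sInf_mem ((basicMaxFracMatchings_nonempty G w).image
    fun x => (oddCycles G x).ncard)
  obtain ⟨σ, rfl, hσ⟩ := hy.exists_isSaturating hx
  obtain ⟨m, hm, hmσ, hodd, hsep⟩ := exists_involutive_odd_of_fixed σ
  refine ⟨m, hσ.movesAlong.of_forall_or hmσ, hm, le_of_le_of_eq ?_ hγ⟩
  have hex : ∀ u ∈ {u | 0 < y u ∧ m u = u}, ∃ C ∈ oddCycles G (permVec σ), u ∈ C.verts := by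
    rintro u ⟨hu, hmu⟩
    have hper := (hodd u hmu).resolve_left (hσ.ne u hu)
    exact exists_mem_oddCycles (hσ.movesAlong.mono tightGraph_le)
      (mem_longVerts_of_odd_minimalPeriod (hσ.ne u hu) hper) hper
  choose! C hC huC using hex
  refine Set.ncard_le_ncard_of_injOn C hC (fun u hu v hv huv => ?_) (Set.toFinite _)
  have hsame : σ.SameCycle u v :=
    (mem_verts_iff_of_mem_oddCycles (hC u hu) (huC u hu) v).1 (huv ▸ huC v hv)
  exact (hsep u v hu.2 hv.2 hsame).resolve_left (hσ.ne u hu.1)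

theorem gamma_le_gamma_deleteIncidenceSet_add_one (G : SimpleGraph V) (w : Sym2 V → ℝ) (v : V) :
    gamma G w ≤ gamma (G.deleteIncidenceSet v) w + 1 := by
  classical
  obtain ⟨y, hy, hy'⟩ := exists_common_isOptCover G w v
  obtain ⟨m, hmT, hm, hcard⟩ := hy'.exists_involutive_ncard_le_gamma
  rw [tightGraph_deleteIncidenceSet] at hmT
  calc gamma G w ≤ {u | 0 < y u ∧ m u = u}.ncard :=
        hy.gamma_le (hmT.mono (SimpleGraph.deleteIncidenceSet_le _ v)) hm
    _ ≤ (insert v {u | 0 < Function.update y v 0 u ∧ m u = u}).ncard :=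
        Set.ncard_le_ncard (fun u hu => (eq_or_ne u v).imp_right fun h =>
          by rwa [Set.mem_ofPred_eq, Function.update_of_ne h]) (Set.toFinite _)
    _ ≤ gamma (G.deleteIncidenceSet v) w + 1 :=
        (Set.ncard_insert_le _ _).trans (Nat.add_le_add_right hcard 1)

theorem gamma_deleteIncidenceSet_le_gamma_add_one (G : SimpleGraph V) (w : Sym2 V → ℝ) (v : V) :
    gamma (G.deleteIncidenceSet v) w ≤ gamma G w + 1 := by
  classical
  obtain ⟨y, hy, hy'⟩ := exists_common_isOptCover G w v
  obtain ⟨m, hmT, hm, hcard⟩ := hy.exists_involutive_ncard_le_gamma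
  obtain ⟨m', hm', hfix, hm'm, hmiss⟩ := exists_involutive_fixing hm v
  have hm'T : MovesAlong (tightGraph G w y) m' :=
    hmT.of_forall_or fun u => (hm'm u).imp_right Or.inl
  calc gamma (G.deleteIncidenceSet v) w
      ≤ {u | 0 < Function.update y v 0 u ∧ m' u = u}.ncard :=
        hy'.gamma_le (tightGraph_deleteIncidenceSet (G := G) v ▸ hm'T.deleteIncidenceSet hfix) hm'
    _ ≤ (insert (m v) {u | 0 < y u ∧ m u = u}).ncard := by
        refine Set.ncard_le_ncard (fun u ⟨hu, hm'u⟩ => ?_) (Set.toFinite _)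
        have huv : u ≠ v := by
          rintro rfl
          simp at hu
        rw [Function.update_of_ne huv] at hu
        exact (hmiss u hm'u).symm.imp (·.resolve_left huv) fun h => ⟨hu, h⟩
    _ ≤ gamma G w + 1 := (Set.ncard_insert_le _ _).trans (Nat.add_le_add_right hcard 1)

theorem gamma_le_gamma_deleteEdges_singleton (G : SimpleGraph V) (w : Sym2 V → ℝ) (e : Sym2 V) :
    gamma G w ≤ gamma (G.deleteEdges {e}) w + 2 := by
  induction e with
  | _ a b =>
    have hdel : (G.deleteEdges {s(a, b)}).deleteIncidenceSet a = G.deleteIncidenceSet a := by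
      ext u v
      simp only [SimpleGraph.deleteIncidenceSet_adj, SimpleGraph.deleteEdges_adj,
        Set.mem_singleton_iff, Sym2.eq_iff]
      tauto
    have hG := gamma_le_gamma_deleteIncidenceSet_add_one G w a
    have hGe := gamma_deleteIncidenceSet_le_gamma_add_one (G.deleteEdges {s(a, b)}) w a
    rw [hdel] at hGe
    lia

theorem gamma_le_gamma_deleteEdges (G : SimpleGraph V) (w : Sym2 V → ℝ) (F : Finset (Sym2 V)) :
    gamma G w ≤ gamma (G.deleteEdges (F : Set (Sym2 V))) w + 2 * F.card := by
  classical
  induction F using Finset.induction_on with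
  | empty => simp
  | insert e F he ih =>
    have h := gamma_le_gamma_deleteEdges_singleton (G.deleteEdges (F : Set (Sym2 V))) w e
    rw [SimpleGraph.deleteEdges_deleteEdges, Set.union_singleton, ← Finset.coe_insert] at h
    rw [Finset.card_insert_of_notMem he]
    lia

end Gamma

section Stability

variable {V : Type*} {G : SimpleGraph V} {m : Equiv.Perm V}

theorem exists_involutive_of_isMatching {M : G.Subgraph} (hM : M.IsMatching) :
    ∃ m : Equiv.Perm V, Function.Involutive m ∧ ∀ u v, M.Adj u v ↔ u ≠ v ∧ m u = v := by
  classical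
  have hex : ∀ u, ∃ v, (u ∈ M.verts → M.Adj u v) ∧ (u ∉ M.verts → v = u) := fun u => by
    by_cases hu : u ∈ M.verts
    · obtain ⟨v, hv, -⟩ := hM hu
      exact ⟨v, fun _ => hv, fun h => absurd hu h⟩
    · exact ⟨u, fun h => absurd h hu, fun _ => rfl⟩
  choose f hadj hfix using hex
  have hinv : Function.Involutive f := fun u => by
    by_cases hu : u ∈ M.verts
    · have h := hadj u hu
      exact hM.eq_of_adj_left (hadj _ (M.edge_vert h.symm)) h.symm
    · rw [hfix u hu, hfix u hu]
  refine ⟨hinv.toPerm, hinv, fun u v => ⟨fun h => ⟨h.ne, ?_⟩, ?_⟩⟩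
  · exact hM.eq_of_adj_left (hadj u (M.edge_vert h)) h
  · rintro ⟨hne, rfl⟩
    exact hadj u (not_not.1 fun hu => hne (hfix u hu).symm)

theorem exists_isMatching_of_involutive (hmG : MovesAlong G m) (hm : Function.Involutive m) :
    ∃ M : G.Subgraph, M.IsMatching ∧ ∀ u v, M.Adj u v ↔ u ≠ v ∧ m u = v := by
  refine ⟨⟨{u | m u ≠ u}, fun u v => u ≠ v ∧ m u = v, ?_, ?_, ⟨?_⟩⟩, ?_, fun _ _ => Iff.rfl⟩
  · rintro u _ ⟨hne, rfl⟩
    exact (hmG u).resolve_left hne.symm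
  · rintro u _ ⟨hne, rfl⟩
    exact hne.symm
  · rintro u _ ⟨hne, rfl⟩
    exact ⟨hne.symm, hm u⟩
  · exact fun u hu => ⟨m u, ⟨Ne.symm hu, rfl⟩, fun v hv => hv.2.symm⟩

variable [Fintype V] {w : Sym2 V → ℝ} {y : V → ℝ}

theorem fracWeight_permVec_eq_subgraphWeight (w : Sym2 V → ℝ) (hm : Function.Involutive m)
    {M : G.Subgraph} (hM : ∀ u v, M.Adj u v ↔ u ≠ v ∧ m u = v) :
    fracWeight G w (permVec m) = subgraphWeight G w M := by
  classical
  rw [fracWeight, subgraphWeight, Finset.sum_filter]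
  refine Finset.sum_congr rfl fun e _ => ?_
  induction e with
  | _ a b =>
    rw [permVec_mk, SimpleGraph.Subgraph.mem_edgeSet, hM, hm.eq_iff, eq_comm (a := a) (b := m b)]
    by_cases hab : a = b <;> by_cases hmab : m b = a <;> simp [hab, hmab]

theorem isGreatest_nu (G : SimpleGraph V) (w : Sym2 V → ℝ) :
    IsGreatest {r | ∃ m, MovesAlong G m ∧ Function.Involutive m ∧ fracWeight G w (permVec m) = r}
      (nu G w) := by
  have hset : {r | ∃ m, MovesAlong G m ∧ Function.Involutive m ∧ fracWeight G w (permVec m) = r} =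
      {r | ∃ M : G.Subgraph, M.IsMatching ∧ subgraphWeight G w M = r} := by
    ext r
    constructor
    · rintro ⟨m, hmG, hm, rfl⟩
      obtain ⟨M, hM, hMm⟩ := exists_isMatching_of_involutive hmG hm
      exact ⟨M, hM, (fracWeight_permVec_eq_subgraphWeight w hm hMm).symm⟩
    · rintro ⟨M, hM, rfl⟩
      obtain ⟨m, hm, hMm⟩ := exists_involutive_of_isMatching hM
      refine ⟨m, fun u => or_iff_not_imp_left.2 fun hu => ?_, hm,
        fracWeight_permVec_eq_subgraphWeight w hm hMm⟩
      exact ((hMm u _).2 ⟨Ne.symm hu, rfl⟩).adj_sub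
  rw [nu, ← hset]
  have hfin : {r | ∃ m, MovesAlong G m ∧ Function.Involutive m ∧
      fracWeight G w (permVec m) = r}.Finite :=
    (Set.finite_range fun m => fracWeight G w (permVec m)).subset fun _ ⟨m, _, _, hr⟩ => ⟨m, hr⟩
  exact ⟨Set.Nonempty.csSup_mem ⟨_, 1, fun _ => Or.inl rfl, fun _ => rfl, rfl⟩ hfin,
    fun _ hr => le_csSup hfin.bddAbove hr⟩

theorem gamma_eq_zero_of_isStable (h : IsStable G w) : gamma G w = 0 := by
  obtain ⟨y, hy⟩ := exists_isOptCover G w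
  obtain ⟨m, hmG, hm, hmw⟩ := (isGreatest_nu G w).1
  have hsat := hy.isSaturating_of_sum_le hmG (by rw [hmw, ← hy.nuFrac_eq, h])
  have hmiss : {u | 0 < y u ∧ m u = u} = ∅ :=
    Set.eq_empty_of_forall_notMem fun u hu => hsat.ne u hu.1 hu.2
  simpa [hmiss] using hy.gamma_le hsat.movesAlong hm

theorem IsFracCover.isStable_of_involutive (hy : IsFracCover G w y)
    (hmy : IsSaturating (tightGraph G w y) {u | 0 < y u} m) (hm : Function.Involutive m) :
    IsStable G w := by
  refine le_antisymm ?_ ?_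
  · obtain ⟨n, hnG, -, hn⟩ := (isGreatest_nu G w).1
    exact hn ▸ fracWeight_le_nuFrac hnG.permVec_mem_fracMatchings
  · rw [(hy.isOptCover_of_isSaturating hmy).nuFrac_eq, ← hy.fracWeight_permVec hmy]
    exact (isGreatest_nu G w).2 ⟨m, hmy.movesAlong.mono tightGraph_le, hm, rfl⟩

theorem IsEdgeStabilizer.gamma_le {F : Finset (Sym2 V)} (hF : IsEdgeStabilizer G w F) :
    gamma G w ≤ 2 * F.card := by
  simpa [gamma_eq_zero_of_isStable hF.2] using gamma_le_gamma_deleteEdges G w F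

end Stability

section TwoTriangles

/-- The graph of the counterexample: the triangles `012` and `345`, joined by the path `0673`. -/
def twoTriangles : SimpleGraph (Fin 8) :=
  SimpleGraph.fromEdgeSet
    {s(0, 1), s(0, 2), s(1, 2), s(3, 4), s(3, 5), s(4, 5), s(0, 6), s(6, 7), s(7, 3)}

instance : DecidableRel twoTriangles.Adj := fun _ _ =>
  decidable_of_iff _ (SimpleGraph.fromEdgeSet_adj _).symm

/-- The weights of the counterexample, two on the triangles and one on the path joining them. -/
noncomputable def twoTrianglesWeight (e : Sym2 (Fin 8)) : ℝ := if 6 ≤ e.sup then 1 else 2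

/-- The covers of `twoTriangles` used as optimality certificates, with value one on the triangles
and value `t` at the two inner vertices of the path. -/
noncomputable def twoTrianglesCover (t : ℝ) (u : Fin 8) : ℝ := if 6 ≤ u then t else 1

theorem twoTrianglesWeight_pos (e : Sym2 (Fin 8)) : 0 < twoTrianglesWeight e := by
  rw [twoTrianglesWeight]
  split_ifs <;> norm_num

theorem twoTrianglesCover_half_pos (u : Fin 8) : 0 < twoTrianglesCover (1 / 2) u := by
  rw [twoTrianglesCover]
  split_ifs <;> norm_num

theorem isFracCover_half :
    IsFracCover twoTriangles twoTrianglesWeight (twoTrianglesCover (1 / 2)) :=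
  ⟨fun u => (twoTrianglesCover_half_pos u).le, fun u v _ => by
    by_cases hu : 6 ≤ u <;> by_cases hv : 6 ≤ v <;>
      norm_num [twoTrianglesWeight, twoTrianglesCover, hu, hv]⟩

theorem tightGraph_half_adj {u v : Fin 8} :
    (tightGraph twoTriangles twoTrianglesWeight (twoTrianglesCover (1 / 2))).Adj u v ↔
      twoTriangles.Adj u v ∧ (6 ≤ u ↔ 6 ≤ v) := by
  refine and_congr_right fun _ => ?_
  by_cases hu : 6 ≤ u <;> by_cases hv : 6 ≤ v <;>
    norm_num [twoTrianglesWeight, twoTrianglesCover, hu, hv]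

theorem movesAlong_tightGraph_half_iff {σ : Equiv.Perm (Fin 8)} :
    MovesAlong (tightGraph twoTriangles twoTrianglesWeight (twoTrianglesCover (1 / 2))) σ ↔
      ∀ u, σ u = u ∨ twoTriangles.Adj u (σ u) ∧ (6 ≤ u ↔ 6 ≤ σ u) :=
  forall_congr' fun _ => or_congr_right tightGraph_half_adj

theorem isOptCover_half :
    IsOptCover twoTriangles twoTrianglesWeight (twoTrianglesCover (1 / 2)) := by
  have hne : ∀ u, (c[0, 1, 2] * c[3, 4, 5] * c[6, 7] : Equiv.Perm (Fin 8)) u ≠ u := by decide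
  exact isFracCover_half.isOptCover_of_isSaturating
    ⟨movesAlong_tightGraph_half_iff.2 (by decide), fun u _ => hne u⟩

theorem gamma_twoTriangles_le : gamma twoTriangles twoTrianglesWeight ≤ 2 := by
  let m : Equiv.Perm (Fin 8) := c[1, 2] * c[4, 5] * c[6, 7]
  have hm : MovesAlong (tightGraph twoTriangles twoTrianglesWeight (twoTrianglesCover (1 / 2))) m :=
    movesAlong_tightGraph_half_iff.2 (by decide)
  have hfix : ∀ u, m u = u → u = 0 ∨ u = 3 := by decide
  refine (isOptCover_half.gamma_le hm (by decide : ∀ u, m (m u) = u)).trans ?_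
  rw [← Set.ncard_pair (by decide : (0 : Fin 8) ≠ 3)]
  exact Set.ncard_le_ncard (fun u hu => hfix u hu.2) (Set.toFinite _)

theorem exists_fixed_of_odd_card {V : Type*} {m : V → V} (hm : Function.Involutive m)
    {S : Finset V} (hS : Odd S.card) (hmS : ∀ u ∈ S, m u ∈ S) : ∃ u ∈ S, m u = u := by
  obtain ⟨u, hu, h⟩ := exists_isolated_of_odd_card (r := fun a b => m a = b)
    (fun a b h => by rw [← h, hm]) hS fun c _ a _ b _ ha hb _ _ => ha.symm.trans hb
  exact ⟨u, hu, h _ (hmS u hu) rfl⟩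

theorem two_le_gamma_twoTriangles : 2 ≤ gamma twoTriangles twoTrianglesWeight := by
  obtain ⟨m, hmT, hm, hle⟩ := isOptCover_half.exists_involutive_ncard_le_gamma
  refine le_trans ?_ hle
  have hfixed : ∀ S : Finset (Fin 8), Odd S.card →
      (∀ u ∈ S, ∀ v, twoTriangles.Adj u v ∧ (6 ≤ u ↔ 6 ≤ v) → v ∈ S) → ∃ u ∈ S, m u = u :=
    fun S hS hadj => exists_fixed_of_odd_card hm hS fun u hu =>
      (movesAlong_tightGraph_half_iff.1 hmT u).elim (fun h => by rwa [h]) (hadj u hu _)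
  obtain ⟨a, ha, hma⟩ := hfixed {0, 1, 2} (by decide) (by decide)
  obtain ⟨b, hb, hmb⟩ := hfixed {3, 4, 5} (by decide) (by decide)
  have hab : a ≠ b := fun h =>
    Finset.disjoint_left.1 (by decide : Disjoint {0, 1, 2} ({3, 4, 5} : Finset (Fin 8))) ha (h ▸ hb)
  rw [← Set.ncard_pair hab]
  refine Set.ncard_le_ncard ?_ (Set.toFinite _)
  rintro u (rfl | rfl)
  exacts [⟨twoTrianglesCover_half_pos _, hma⟩, ⟨twoTrianglesCover_half_pos _, hmb⟩]

theorem tight_zero_of_adj {u v : Fin 8} (h : (twoTriangles.deleteEdges {s(6, 7)}).Adj u v) :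
    twoTrianglesWeight s(u, v) = twoTrianglesCover 0 u + twoTrianglesCover 0 v := by
  have hpath : ∀ u v, twoTriangles.Adj u v → 6 ≤ u → 6 ≤ v → s(u, v) = s(6, 7) := by decide
  rw [SimpleGraph.deleteEdges_adj, Set.mem_singleton_iff] at h
  by_cases hu : 6 ≤ u <;> by_cases hv : 6 ≤ v
  · exact absurd (hpath u v h.1 hu hv) h.2
  all_goals
    norm_num [twoTrianglesWeight, twoTrianglesCover, hu, hv]

theorem isStable_twoTriangles_deleteEdges :
    IsStable (twoTriangles.deleteEdges {s(6, 7)}) twoTrianglesWeight := by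
  let m : Equiv.Perm (Fin 8) := c[0, 6] * c[1, 2] * c[3, 7] * c[4, 5]
  have hadj : ∀ u, (twoTriangles.deleteEdges {s(6, 7)}).Adj u (m u) := fun u =>
    SimpleGraph.deleteEdges_adj.2 (by revert u; decide)
  have hcover : IsFracCover (twoTriangles.deleteEdges {s(6, 7)}) twoTrianglesWeight
      (twoTrianglesCover 0) :=
    ⟨fun u => by rw [twoTrianglesCover]; split_ifs <;> norm_num,
      fun u v h => (tight_zero_of_adj h).le⟩
  exact hcover.isStable_of_involutive (m := m)
    ⟨fun u => Or.inr ⟨hadj u, tight_zero_of_adj (hadj u)⟩, fun u _ => (hadj u).ne'⟩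
    (by decide : ∀ u, m (m u) = u)

theorem isMinEdgeStabilizer_twoTriangles :
    IsMinEdgeStabilizer twoTriangles twoTrianglesWeight {s(6, 7)} := by
  have hadj : twoTriangles.Adj 6 7 := by decide
  refine ⟨⟨by simpa using hadj, ?_⟩, fun F hF => ?_⟩
  · rw [Finset.coe_singleton]
    exact isStable_twoTriangles_deleteEdges
  · have := hF.gamma_le
    have := two_le_gamma_twoTriangles
    rw [Finset.card_singleton]
    lia

end TwoTriangles

end WeightedMatching

theorem mainTheorem6_general :
    (∀ (V : Type*) [Fintype V] (G : SimpleGraph V) (w : Sym2 V → ℝ),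
      (∀ e, (WeightedMatching.gamma (G.deleteEdges {e}) w : ℤ) ≥ WeightedMatching.gamma G w - 2) ∧
      (∀ F : Finset (Sym2 V), WeightedMatching.IsEdgeStabilizer G w F →
        (F.card : ℤ) ≥ ⌈(WeightedMatching.gamma G w : ℝ) / 2⌉)) ∧
    (∃ (G : SimpleGraph (Fin 8)) (w : Sym2 (Fin 8) → ℝ) (e : Sym2 (Fin 8)),
      (∀ e' ∈ G.edgeSet, 0 < w e') ∧
        WeightedMatching.gamma G w = 2 ∧
        WeightedMatching.IsMinEdgeStabilizer G w {e}) := by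
  open WeightedMatching in
  refine ⟨fun V _ G w => ⟨fun e => ?_, fun F hF => ?_⟩, twoTriangles, twoTrianglesWeight, s(6, 7),
    fun e _ => twoTrianglesWeight_pos e, gamma_twoTriangles_le.antisymm two_le_gamma_twoTriangles,
    isMinEdgeStabilizer_twoTriangles⟩
  · have := gamma_le_gamma_deleteEdges_singleton G w e
    lia
  · have h : (gamma G w : ℝ) ≤ 2 * F.card := by exact_mod_cast hF.gamma_le
    refine Int.ceil_le.2 ?_
    push_cast
    linarith

theorem mainTheorem6 :
    (∀ (V : Type*) [Fintype V] (G : SimpleGraph V) (w : Sym2 V → ℝ),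
      (∀ e ∈ G.edgeSet, 0 ≤ w e) →
        (∀ e ∈ G.edgeSet,
          (WeightedMatching.gamma (G.deleteEdges {e}) w : ℤ) ≥ WeightedMatching.gamma G w - 2) ∧
        (∀ F : Finset (Sym2 V), WeightedMatching.IsEdgeStabilizer G w F →
          (F.card : ℤ) ≥ ⌈(WeightedMatching.gamma G w : ℝ) / 2⌉)) ∧
    (∃ (G : SimpleGraph (Fin 8)) (w : Sym2 (Fin 8) → ℝ) (e : Sym2 (Fin 8)),
      (∀ e' ∈ G.edgeSet, 0 < w e') ∧
        WeightedMatching.gamma G w = 2 ∧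
        WeightedMatching.IsMinEdgeStabilizer G w {e}) :=
  mainTheorem6_general.imp_left fun h V _ G w _ => (h V G w).imp_left fun he e _ => he e
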